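/- Let $n\ge 0$ be an integer and let $M$ be a smooth manifold of dimension $2n+1$ with an almost contact B-metric structure $(\varphi,\xi,\eta,g)$: $\varphi$ is a smooth field of endomorphisms of $TM$, $\xi$ a smooth vector field, $\eta$ a smooth $1$-form and $g$ a pseudo-Riemannian metric of signature $(n+1,n)$ such that, for all tangent vectors $x,y$ at a common point, $$\varphi\xi=0,\quad \varphi^2x=-x+\eta(x)\xi,\quad \eta\circ\varphi=0,\quad \eta(\xi)=1,\quad g(\varphi x,\varphi y)=-g(x,y)+\eta(x)\eta(y).$$ Let $\nabla$ be the Levi-Civita connection of $g$, let $R(x,y)z=\nabla_x\nabla_yz-\nabla_y\nabla_xz-\nabla_{[x,y]}z$ be its curvature, let $\rho(y,z)=\operatorname{tr}\bigl(x\mapsto R(x,y)z\bigr)$ be its Ricci tensor, and let $\tilde g(x,y)=g(x,\varphi y)+\eta(x)\eta(y)$. Assume that the structure is Sasaki-like, that is, $$(\nabla_x\varphi)y=-g(x,y)\xi-\eta(y)x+2\eta(x)\eta(y)\xi\qquad\text{for all } x,y.$$ The structure is called Einstein-like with constants $(a,b,c)$ if $\rho=a\,g+b\,\tilde g+c\,\eta\otimes\eta$,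 where $a,b,c\in\mathbb R$; it is called $\eta$-Einstein if moreover $b=0$, and Einstein-like if such real constants $a,b,c$ exist. It admits a Ricci-like soliton with potential a smooth vector field $v$ and constants $(\lambda,\mu,\nu)\in\mathbb R^3$ if $\tfrac12\mathcal L_vg+\rho+\lambda g+\mu\tilde g+\nu\,\eta\otimes\eta=0$, where $\mathcal L$ is the Lie derivative. 1. If the structure is Einstein-like, then it is $\eta$-Einstein with constants $(0,0,2n)$, that is, $\rho=2n\,\eta\otimes\eta$, and it admits a Ricci-like soliton with potential $\xi$ and constants $(0,1,-2n-1)$. 2. The structure is $\eta$-Einstein with constants $(0,0,2n)$ if and only if it admits a Ricci-like soliton with potential $\xi$ and constants $(0,1,-2n-1)$. -/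

import Mathlib

open Bundle
open scoped Manifold ContDiff

noncomputable section

/-! ### Local formulas

Tensor calculus in a coordinate domain of `ℝᵐ`: `G` is the coordinate expression of a
pseudo-Riemannian metric, `Φ` of a field of endomorphisms, `V` of a vector field. -/

namespace LocalGeometry

variable {m : ℕ}

/-- The Christoffel map `Γ_y(u, v) = Γᵏᵢⱼ uⁱ vʲ ∂ₖ` of the Levi-Civita connection of `G`:
the vector with `2 G(Γ(u,v), w) = (∂ᵤG)(v,w) + (∂ᵥG)(u,w) - (∂_w G)(u,v)` for all `w`. -/
def christoffel (G : EuclideanSpace ℝ (Fin m) →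
      (EuclideanSpace ℝ (Fin m) →L[ℝ] EuclideanSpace ℝ (Fin m) →L[ℝ] ℝ))
    (y u v : EuclideanSpace ℝ (Fin m)) : EuclideanSpace ℝ (Fin m) :=
  (G y).inverse ((1 / 2 : ℝ) •
    (fderiv ℝ G y u v + fderiv ℝ G y v u - ((fderiv ℝ G y).flip u).flip v))

/-- The covariant derivative `(∇ᵤ Φ) v` of a field of endomorphisms, for the Levi-Civita
connection `∇` of `G`. -/
def nablaEnd (G : EuclideanSpace ℝ (Fin m) →
      (EuclideanSpace ℝ (Fin m) →L[ℝ] EuclideanSpace ℝ (Fin m) →L[ℝ] ℝ))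
    (Φ : EuclideanSpace ℝ (Fin m) →
      (EuclideanSpace ℝ (Fin m) →L[ℝ] EuclideanSpace ℝ (Fin m)))
    (y u v : EuclideanSpace ℝ (Fin m)) : EuclideanSpace ℝ (Fin m) :=
  fderiv ℝ Φ y u v + christoffel G y u (Φ y v) - Φ y (christoffel G y u v)

/-- The curvature `R(u, v) w = ∇ᵤ∇ᵥ w - ∇ᵥ∇ᵤ w` of the Levi-Civita connection of `G`, where
`u`, `v`, `w` are extended to vector fields with constant coefficients (so `[u, v] = 0`). -/
def curvature (G : EuclideanSpace ℝ (Fin m) →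
      (EuclideanSpace ℝ (Fin m) →L[ℝ] EuclideanSpace ℝ (Fin m) →L[ℝ] ℝ))
    (y u v w : EuclideanSpace ℝ (Fin m)) : EuclideanSpace ℝ (Fin m) :=
  fderiv ℝ (fun z => christoffel G z v w) y u - fderiv ℝ (fun z => christoffel G z u w) y v
    + christoffel G y u (christoffel G y v w) - christoffel G y v (christoffel G y u w)

/-- The Ricci tensor: `ρ(v, w)` is the trace of `u ↦ R(u, v) w`. -/
def ricci (G : EuclideanSpace ℝ (Fin m) →
      (EuclideanSpace ℝ (Fin m) →L[ℝ] EuclideanSpace ℝ (Fin m) →L[ℝ] ℝ))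
    (y v w : EuclideanSpace ℝ (Fin m)) : ℝ :=
  ∑ i : Fin m, curvature G y (EuclideanSpace.single i 1) v w i

/-- The Lie derivative `(𝓛_V G)(u, w)` of the metric along the vector field `V`. -/
def lieMetric (V : EuclideanSpace ℝ (Fin m) → EuclideanSpace ℝ (Fin m))
    (G : EuclideanSpace ℝ (Fin m) →
      (EuclideanSpace ℝ (Fin m) →L[ℝ] EuclideanSpace ℝ (Fin m) →L[ℝ] ℝ))
    (y u w : EuclideanSpace ℝ (Fin m)) : ℝ :=
  fderiv ℝ G y (V y) u w + G y (fderiv ℝ V y u) w + G y u (fderiv ℝ V y w)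

end LocalGeometry

/-- An almost contact B-metric structure `(φ, ξ, η, g)` on a smooth manifold `M` of dimension
`2n+1`: smooth tensor fields with the algebraic relations below, where `g` is a
pseudo-Riemannian metric of signature `(n+1, n)`. -/
structure AlmostContactBMetric (n : ℕ) (M : Type*) [TopologicalSpace M]
    [ChartedSpace (EuclideanSpace ℝ (Fin (2 * n + 1))) M]
    [IsManifold (𝓡 (2 * n + 1)) ∞ M] where
  φ : ∀ p : M, TangentSpace (𝓡 (2 * n + 1)) p →L[ℝ] TangentSpace (𝓡 (2 * n + 1)) p
  ξ : ∀ p : M, TangentSpace (𝓡 (2 * n + 1)) p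
  η : ∀ p : M, TangentSpace (𝓡 (2 * n + 1)) p →L[ℝ] ℝ
  g : ∀ p : M, TangentSpace (𝓡 (2 * n + 1)) p →L[ℝ] TangentSpace (𝓡 (2 * n + 1)) p →L[ℝ] ℝ
  contMDiff_φ : ContMDiff (𝓡 (2 * n + 1)) ((𝓡 (2 * n + 1)).prod
      𝓘(ℝ, EuclideanSpace ℝ (Fin (2 * n + 1)) →L[ℝ] EuclideanSpace ℝ (Fin (2 * n + 1)))) ∞
    (fun p => TotalSpace.mk'
      (EuclideanSpace ℝ (Fin (2 * n + 1)) →L[ℝ] EuclideanSpace ℝ (Fin (2 * n + 1))) p (φ p))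
  contMDiff_ξ : ContMDiff (𝓡 (2 * n + 1)) (𝓡 (2 * n + 1)).tangent ∞
    (fun p => (⟨p, ξ p⟩ : TangentBundle (𝓡 (2 * n + 1)) M))
  contMDiff_η : ContMDiff (𝓡 (2 * n + 1)) ((𝓡 (2 * n + 1)).prod
      𝓘(ℝ, EuclideanSpace ℝ (Fin (2 * n + 1)) →L[ℝ] ℝ)) ∞
    (fun p => TotalSpace.mk' (EuclideanSpace ℝ (Fin (2 * n + 1)) →L[ℝ] ℝ) p (η p))
  contMDiff_g : ContMDiff (𝓡 (2 * n + 1)) ((𝓡 (2 * n + 1)).prod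
      𝓘(ℝ, EuclideanSpace ℝ (Fin (2 * n + 1)) →L[ℝ]
        EuclideanSpace ℝ (Fin (2 * n + 1)) →L[ℝ] ℝ)) ∞
    (fun p => TotalSpace.mk' (EuclideanSpace ℝ (Fin (2 * n + 1)) →L[ℝ]
        EuclideanSpace ℝ (Fin (2 * n + 1)) →L[ℝ] ℝ) p (g p))
  g_symm : ∀ p x y, g p x y = g p y x
  /-- At every point there is a pseudo-orthonormal basis with `n+1` vectors of square `1` and
  `n` vectors of square `-1`. -/
  g_signature : ∀ p, ∃ b : Module.Basis (Fin (n + 1) ⊕ Fin n) ℝ (TangentSpace (𝓡 (2 * n + 1)) p),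
    ∀ i j, g p (b i) (b j) = if i = j then Sum.elim (fun _ => (1 : ℝ)) (fun _ => -1) i else 0
  φ_ξ : ∀ p, φ p (ξ p) = 0
  φ_φ : ∀ p x, φ p (φ p x) = -x + η p x • ξ p
  η_φ : ∀ p x, η p (φ p x) = 0
  η_ξ : ∀ p, η p (ξ p) = 1
  g_φ_φ : ∀ p x y, g p (φ p x) (φ p y) = -g p x y + η p x * η p y

namespace AlmostContactBMetric

variable {n : ℕ} {M : Type*} [TopologicalSpace M]
  [ChartedSpace (EuclideanSpace ℝ (Fin (2 * n + 1))) M]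
  [IsManifold (𝓡 (2 * n + 1)) ∞ M]

/-- The coordinate expression of a vector field in the chart `e`. -/
def chartVector (v : ∀ p : M, TangentSpace (𝓡 (2 * n + 1)) p)
    (e : OpenPartialHomeomorph M (EuclideanSpace ℝ (Fin (2 * n + 1))))
    (y : EuclideanSpace ℝ (Fin (2 * n + 1))) : EuclideanSpace ℝ (Fin (2 * n + 1)) :=
  mfderiv (𝓡 (2 * n + 1)) (𝓡 (2 * n + 1)) e (e.symm y) (v (e.symm y))

/-- The coordinate expression of the metric `g` in the chart `e`, i.e. its pullback by the inverse
of `e`: `(u, w) ↦ g(de⁻¹ u, de⁻¹ w)`. -/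
def chartMetric (S : AlmostContactBMetric n M)
    (e : OpenPartialHomeomorph M (EuclideanSpace ℝ (Fin (2 * n + 1))))
    (y : EuclideanSpace ℝ (Fin (2 * n + 1))) :
    EuclideanSpace ℝ (Fin (2 * n + 1)) →L[ℝ] EuclideanSpace ℝ (Fin (2 * n + 1)) →L[ℝ] ℝ :=
  (ContinuousLinearMap.precomp ℝ
      (mfderiv (𝓡 (2 * n + 1)) (𝓡 (2 * n + 1)) e.symm y)).comp
    ((S.g (e.symm y)).comp (mfderiv (𝓡 (2 * n + 1)) (𝓡 (2 * n + 1)) e.symm y))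

/-- The coordinate expression `de ∘ φ ∘ de⁻¹` of `φ` in the chart `e`. -/
def chartPhi (S : AlmostContactBMetric n M)
    (e : OpenPartialHomeomorph M (EuclideanSpace ℝ (Fin (2 * n + 1))))
    (y : EuclideanSpace ℝ (Fin (2 * n + 1))) :
    EuclideanSpace ℝ (Fin (2 * n + 1)) →L[ℝ] EuclideanSpace ℝ (Fin (2 * n + 1)) :=
  (mfderiv (𝓡 (2 * n + 1)) (𝓡 (2 * n + 1)) e (e.symm y)).comp
    ((S.φ (e.symm y)).comp (mfderiv (𝓡 (2 * n + 1)) (𝓡 (2 * n + 1)) e.symm y))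

/-! The following tensors at a point `p` are computed in a chart `e` of the smooth structure around
`p`; as they are tensors, their values do not depend on the choice of `e`. -/

/-- The tangent vector `(∇ₓ φ) y` at `p`, where `∇` is the Levi-Civita connection of `g`. -/
def nablaPhi (S : AlmostContactBMetric n M)
    (e : OpenPartialHomeomorph M (EuclideanSpace ℝ (Fin (2 * n + 1)))) (p : M)
    (x y : TangentSpace (𝓡 (2 * n + 1)) p) : TangentSpace (𝓡 (2 * n + 1)) p :=
  mfderiv (𝓡 (2 * n + 1)) (𝓡 (2 * n + 1)) e.symm (e p)
    (LocalGeometry.nablaEnd (S.chartMetric e) (S.chartPhi e) (e p)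
      (mfderiv (𝓡 (2 * n + 1)) (𝓡 (2 * n + 1)) e p x)
      (mfderiv (𝓡 (2 * n + 1)) (𝓡 (2 * n + 1)) e p y))

/-- The Ricci tensor `ρ(x, y)` of the Levi-Civita connection of `g` at `p`. -/
def ricci (S : AlmostContactBMetric n M)
    (e : OpenPartialHomeomorph M (EuclideanSpace ℝ (Fin (2 * n + 1)))) (p : M)
    (x y : TangentSpace (𝓡 (2 * n + 1)) p) : ℝ :=
  LocalGeometry.ricci (S.chartMetric e) (e p)
    (mfderiv (𝓡 (2 * n + 1)) (𝓡 (2 * n + 1)) e p x)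
    (mfderiv (𝓡 (2 * n + 1)) (𝓡 (2 * n + 1)) e p y)

/-- The Lie derivative `(𝓛_v g)(x, y)` at `p`. -/
def lieMetric (S : AlmostContactBMetric n M) (v : ∀ p : M, TangentSpace (𝓡 (2 * n + 1)) p)
    (e : OpenPartialHomeomorph M (EuclideanSpace ℝ (Fin (2 * n + 1)))) (p : M)
    (x y : TangentSpace (𝓡 (2 * n + 1)) p) : ℝ :=
  LocalGeometry.lieMetric (chartVector v e) (S.chartMetric e) (e p)
    (mfderiv (𝓡 (2 * n + 1)) (𝓡 (2 * n + 1)) e p x)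
    (mfderiv (𝓡 (2 * n + 1)) (𝓡 (2 * n + 1)) e p y)

/-- The associated B-metric `g̃(x, y) = g(x, φ y) + η(x) η(y)`. -/
def assocMetric (S : AlmostContactBMetric n M) (p : M)
    (x y : TangentSpace (𝓡 (2 * n + 1)) p) : ℝ :=
  S.g p x (S.φ p y) + S.η p x * S.η p y

/-- Sasaki-like: `(∇ₓ φ) y = -g(x, y) ξ - η(y) x + 2 η(x) η(y) ξ`. -/
def IsSasakiLike (S : AlmostContactBMetric n M) : Prop :=
  ∀ e ∈ IsManifold.maximalAtlas (𝓡 (2 * n + 1)) ∞ M, ∀ p ∈ e.source,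
    ∀ x y : TangentSpace (𝓡 (2 * n + 1)) p,
      S.nablaPhi e p x y
        = -S.g p x y • S.ξ p - S.η p y • x + (2 * S.η p x * S.η p y) • S.ξ p

/-- Einstein-like with constants `(a, b, c)`: `ρ = a g + b g̃ + c η ⊗ η`. -/
def IsEinsteinLikeWith (S : AlmostContactBMetric n M) (a b c : ℝ) : Prop :=
  ∀ e ∈ IsManifold.maximalAtlas (𝓡 (2 * n + 1)) ∞ M, ∀ p ∈ e.source,
    ∀ x y : TangentSpace (𝓡 (2 * n + 1)) p,
      S.ricci e p x y = a * S.g p x y + b * S.assocMetric p x y + c * (S.η p x * S.η p y)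

/-- Einstein-like: Einstein-like with some triplet of constants. -/
def IsEinsteinLike (S : AlmostContactBMetric n M) : Prop :=
  ∃ a b c : ℝ, S.IsEinsteinLikeWith a b c

/-- `η`-Einstein with constants `(a, 0, c)`: `ρ = a g + c η ⊗ η`. -/
def IsEtaEinsteinWith (S : AlmostContactBMetric n M) (a c : ℝ) : Prop :=
  S.IsEinsteinLikeWith a 0 c

/-- The smooth vector field `v` is the potential of a Ricci-like soliton with constants
`(lam, mu, nu)`: `½ 𝓛_v g + ρ + lam g + mu g̃ + nu η ⊗ η = 0`. -/
def IsRicciLikeSoliton (S : AlmostContactBMetric n M)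
    (v : ∀ p : M, TangentSpace (𝓡 (2 * n + 1)) p) (lam mu nu : ℝ) : Prop :=
  ContMDiff (𝓡 (2 * n + 1)) (𝓡 (2 * n + 1)).tangent ∞
      (fun p => (⟨p, v p⟩ : TangentBundle (𝓡 (2 * n + 1)) M)) ∧
    ∀ e ∈ IsManifold.maximalAtlas (𝓡 (2 * n + 1)) ∞ M, ∀ p ∈ e.source,
      ∀ x y : TangentSpace (𝓡 (2 * n + 1)) p,
        1 / 2 * S.lieMetric v e p x y + S.ricci e p x y + lam * S.g p x y
          + mu * S.assocMetric p x y + nu * (S.η p x * S.η p y) = 0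

end AlmostContactBMetric

end

/-!
Write `g, φ, ξ, η` for the structure, `∇` for the Levi-Civita connection. Everything is local and is
proved for the coordinate expressions in a chart, where the Christoffel map `A = Γ` is a smooth
family of symmetric bilinear maps and every covariant identity is obtained by differentiating an
identity which holds on the whole chart domain (`SasakiLikeOn`).

* The formula for `∇φ`, applied to `ξ`, gives `∇ₓ ξ = -φ x` (`SasakiLikeOn.fderiv_V`). Hence
  `½ 𝓛_ξ g (x, y) = -g(x, φ y) = -g̃(x, y) + η(x) η(y)` (`SasakiLikeOn.lieMetric_V`), and the
  soliton equation with potential `ξ` and constants `(0, 1, -2n-1)` literally becomes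
  `ρ = 2n η ⊗ η`. This is the second assertion.
* The Ricci identity for `ξ` is `R(x, y) ξ = η(y) x - η(x) y`, so that `ρ(ξ, ξ) = 2n`; by the pair
  symmetry of `R`, also `R(x, ξ) z = η(z) x - g(x, z) ξ`
  (`SasakiLikeOn.connCurvature_V`, `SasakiLikeOn.connCurvature_snd_V`).
* Differentiating the last formula and inserting the result into the second Bianchi identity
  expresses `𝓛_ξ R` through `R` and `φ` (`SasakiLikeOn.lieDeriv_connCurvature`). Its trace, computed
  with the Ricci identity for `φ` and `tr φ = 0`, says that `𝓛_ξ ρ = 0`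
  (`SasakiLikeOn.lieDeriv_connRicci`).
* If `ρ = a g + b g̃ + c η ⊗ η`, then `ρ(ξ, ξ) = 2n` says `a + b + c = 2n`, while `𝓛_ξ ρ = 0` says
  `a g(x, φ y) = b (g(x, y) - η(x) η(y))`, because the flow of `ξ` rotates `g` and `g̃` into each
  other. Replacing `y` by `φ y` in the latter yields `a (g - η ⊗ η) + b (g̃ - η ⊗ η) = 0`, so
  `ρ = (a + b + c) η ⊗ η = 2n η ⊗ η` (`SasakiLikeOn.connRicci_eq_of_einsteinLike`). This argument
  needs no distinction between `n = 0`, where `a` and `b` are not determined, and `n ≥ 1`.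
-/

noncomputable section

/-! ### Derivatives of maps with values in continuous linear maps -/

section Calculus

variable {E : Type*} [NormedAddCommGroup E] [NormedSpace ℝ E]

/-- Two maps which agree on an open set have the same derivative there. This is how an identity that
holds on a whole chart domain is differentiated. -/
lemma fderiv_apply_eq_of_eqOn {F : Type*} [NormedAddCommGroup F] [NormedSpace ℝ F] {U : Set E}
    (hU : IsOpen U) {f g : E → F} {f' g' : E →L[ℝ] F} {y : E} (hy : y ∈ U)
    (h : ∀ x ∈ U, f x = g x) (hf : HasFDerivAt f f' y) (hg : HasFDerivAt g g' y) (u : E) :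
    f' u = g' u := by
  have : f =ᶠ[nhds y] g := by
    filter_upwards [hU.mem_nhds hy] with x hx using h x hx
  rw [hf.unique (hg.congr_of_eventuallyEq this)]

namespace ContDiffAt
variable {F : Type*} [NormedAddCommGroup F] [NormedSpace ℝ F] {f : E → F} {y : E}

lemma hasFDerivAt_of_infty (h : ContDiffAt ℝ ∞ f y) : HasFDerivAt f (fderiv ℝ f y) y :=
  (h.differentiableAt (by simp)).hasFDerivAt

lemma hasFDerivAt_fderiv_of_infty (h : ContDiffAt ℝ ∞ f y) :
    HasFDerivAt (fderiv ℝ f) (fderiv ℝ (fderiv ℝ f) y) y :=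
  ((h.fderiv_right (m := ∞) (by simp)).differentiableAt (by simp)).hasFDerivAt

lemma fderiv_fderiv_comm (h : ContDiffAt ℝ ∞ f y) (u v : E) :
    fderiv ℝ (fderiv ℝ f) y u v = fderiv ℝ (fderiv ℝ f) y v u :=
  (h.isSymmSndFDerivAt (by simpa using WithTop.coe_le_coe.2 (le_top : (2 : ℕ∞) ≤ ⊤))) u v

end ContDiffAt

lemma HasFDerivAt.clm_apply_const {F F' : Type*} [NormedAddCommGroup F] [NormedSpace ℝ F]
    [NormedAddCommGroup F'] [NormedSpace ℝ F'] {c : E → F →L[ℝ] F'} {c' : E →L[ℝ] F →L[ℝ] F'}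
    {y : E} (h : HasFDerivAt c c' y) (v : F) :
    HasFDerivAt (fun x => c x v) (c'.flip v) y := by
  simpa using h.clm_apply (hasFDerivAt_const v y)

lemma contDiffAt_of_forall_clm_apply {D E F : Type*} [NormedAddCommGroup D] [NormedSpace ℝ D]
    [NormedAddCommGroup E] [NormedSpace ℝ E] [FiniteDimensional ℝ E]
    [NormedAddCommGroup F] [NormedSpace ℝ F] {k : ℕ∞ω} {f : D → E →L[ℝ] F} {U : Set D}
    (hU : IsOpen U) (h : ∀ y ∈ U, ∀ u, ContDiffAt ℝ k (fun x => f x u) y) {y : D} (hy : y ∈ U) :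
    ContDiffAt ℝ k f y :=
  (contDiffOn_clm_apply.2 fun u x hx => (h x hx u).contDiffWithinAt).contDiffAt (hU.mem_nhds hy)

lemma ContDiffAt.fderiv_clm_apply_of_infty {D E F : Type*} [NormedAddCommGroup D]
    [NormedSpace ℝ D] [NormedAddCommGroup E] [NormedSpace ℝ E] [NormedAddCommGroup F]
    [NormedSpace ℝ F] {f : D → E →L[ℝ] F} {y : D} (h : ContDiffAt ℝ ∞ f y) (u : D) (v : E) :
    ContDiffAt ℝ ∞ (fun x => fderiv ℝ f x u v) y :=
  ((h.fderiv_right (m := ∞) (by simp)).clm_apply contDiffAt_const).clm_apply contDiffAt_const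

end Calculus

/-! ### Trace of an endomorphism with `f³ = -f` -/

/-- A real endomorphism with `f³ = -f` has trace zero: its complex eigenvalues are `0`, `i` and
`-i`, so the trace is purely imaginary. -/
lemma LinearMap.trace_eq_zero_of_cube_eq_neg {E : Type*} [AddCommGroup E] [Module ℝ E]
    [FiniteDimensional ℝ E] (f : E →ₗ[ℝ] E) (h : ∀ u, f (f (f u)) = -f u) :
    LinearMap.trace ℝ E f = 0 := by
  classical
  let b := Module.finBasis ℝ E
  let N := LinearMap.toMatrix b b f
  let P := N.map (algebraMap ℝ ℂ)
  have hN : N * (N * N) = -N := by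
    simp only [N, ← LinearMap.toMatrix_mul]
    rw [← map_neg]
    congr 1
    ext u
    simp [h]
  have hP : P * (P * P) = -P := by
    have := congrArg (fun Q => Q.map (algebraMap ℝ ℂ)) hN
    simp only [Matrix.map_mul] at this
    rw [this]
    ext i j
    simp [P]
  have htr : P.trace = ((LinearMap.trace ℝ E f : ℝ) : ℂ) := by
    rw [LinearMap.trace_eq_matrix_trace ℝ b]
    simp [P, N, Matrix.trace]
  have hroots : ∀ z ∈ P.charpoly.roots, z.re = 0 := by
    intro z hz
    have hz' := Polynomial.isRoot_of_mem_roots hz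
    obtain ⟨v, hv⟩ := ((Module.End.hasEigenvalue_iff_isRoot_charpoly (Matrix.toLin' P) z).2
      (by rwa [Matrix.charpoly_toLin'])).exists_hasEigenvector
    have h1 : P.mulVec v = z • v := by simpa using hv.apply_eq_smul
    have h2 : (z * z * z + z) • v = 0 := by
      have := congrArg (fun Q => Matrix.mulVec Q v) hP
      simp only [← Matrix.mulVec_mulVec, Matrix.neg_mulVec, h1, Matrix.mulVec_smul, smul_smul]
        at this
      rw [add_smul, this, neg_add_cancel]
    have h3 := (smul_eq_zero.1 h2).resolve_right hv.2
    have h4 : z * (z * z + 1) = 0 := by rw [← h3]; ring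
    rcases mul_eq_zero.1 h4 with h5 | h5
    · simp [h5]
    · have hre := congrArg Complex.re h5
      have him := congrArg Complex.im h5
      simp at hre him
      by_contra h0
      have : z.im = 0 := by
        have : z.re * z.im = 0 := by linarith
        exact (mul_eq_zero.1 this).resolve_left h0
      rw [this] at hre
      nlinarith [mul_self_nonneg z.re]
  have hsum : P.trace.re = 0 := by
    rw [Matrix.trace_eq_sum_roots_charpoly]
    have : ∀ s : Multiset ℂ, (∀ z ∈ s, z.re = 0) → s.sum.re = 0 := by
      intro s
      induction s using Multiset.induction_on with
      | empty => simp
      | cons a s ih =>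
        intro hs
        simp [hs a (by simp), ih fun z hz => hs z (by simp [hz])]
    exact this _ hroots
  rw [htr] at hsum
  simpa using hsum

/-! ### Curvature of Sasaki-like structures on an open set -/

section LocalStructure

variable {E : Type*} [NormedAddCommGroup E] [NormedSpace ℝ E]

/-- The coordinate expression, on the open set `U`, of a Sasaki-like almost contact B-metric
structure: the metric `G`, the endomorphism `Φ`, the vector field `V` (standing for `ξ`), the form `H`
(standing for `η`), and the Levi-Civita connection of `G`, encoded by its Christoffel map `A`. The
fields `A_symm` and `fderiv_G` say that the connection is torsion-free and metric. Of the signature of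
`G` only nondegeneracy is kept. -/
structure SasakiLikeOn (U : Set E) (G : E → E →L[ℝ] E →L[ℝ] ℝ) (A : E → E →L[ℝ] E →L[ℝ] E)
    (Φ : E → E →L[ℝ] E) (V : E → E) (H : E → E →L[ℝ] ℝ) : Prop where
  isOpen : IsOpen U
  contDiff_G : ∀ y ∈ U, ContDiffAt ℝ ∞ G y
  contDiff_A : ∀ y ∈ U, ContDiffAt ℝ ∞ A y
  contDiff_Φ : ∀ y ∈ U, ContDiffAt ℝ ∞ Φ y
  contDiff_V : ∀ y ∈ U, ContDiffAt ℝ ∞ V y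
  contDiff_H : ∀ y ∈ U, ContDiffAt ℝ ∞ H y
  G_symm : ∀ y ∈ U, ∀ u v, G y u v = G y v u
  G_nondeg : ∀ y ∈ U, ∀ u, (∀ v, G y u v = 0) → u = 0
  A_symm : ∀ y ∈ U, ∀ u v, A y u v = A y v u
  fderiv_G : ∀ y ∈ U, ∀ u v w, fderiv ℝ G y u v w = G y (A y u v) w + G y v (A y u w)
  Φ_V : ∀ y ∈ U, Φ y (V y) = 0
  Φ_Φ : ∀ y ∈ U, ∀ u, Φ y (Φ y u) = -u + H y u • V y
  H_Φ : ∀ y ∈ U, ∀ u, H y (Φ y u) = 0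
  H_V : ∀ y ∈ U, H y (V y) = 1
  G_Φ_Φ : ∀ y ∈ U, ∀ u v, G y (Φ y u) (Φ y v) = -G y u v + H y u * H y v
  nabla_Φ : ∀ y ∈ U, ∀ u v, fderiv ℝ Φ y u v + A y u (Φ y v) - Φ y (A y u v)
    = -G y u v • V y - H y v • u + (2 * H y u * H y v) • V y

/-- The curvature `R(u, v) w` of the connection with Christoffel map `A`, for constant extensions of
`u`, `v`, `w`. -/
def connCurvature (A : E → E →L[ℝ] E →L[ℝ] E) (y u v w : E) : E :=
  fderiv ℝ A y u v w - fderiv ℝ A y v u w + A y u (A y v w) - A y v (A y u w)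

lemma connCurvature_antisymm (A : E → E →L[ℝ] E →L[ℝ] E) (y u v w : E) :
    connCurvature A y u v w = -connCurvature A y v u w := by
  simp only [connCurvature]
  abel

namespace SasakiLikeOn

variable {U : Set E} {G : E → E →L[ℝ] E →L[ℝ] ℝ} {A : E → E →L[ℝ] E →L[ℝ] E}
    {Φ : E → E →L[ℝ] E} {V : E → E} {H : E → E →L[ℝ] ℝ}

lemma G_V (S : SasakiLikeOn U G A Φ V H) {y : E} (hy : y ∈ U) (u : E) : G y u (V y) = H y u := by
  have h := S.G_Φ_Φ y hy u (V y)
  rw [S.Φ_V y hy, S.H_V y hy, map_zero] at h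
  linarith

/-- `φ` is self-adjoint for `g`. -/
lemma G_Φ_comm (S : SasakiLikeOn U G A Φ V H) {y : E} (hy : y ∈ U) (u v : E) :
    G y (Φ y u) v = G y u (Φ y v) := by
  have h := S.G_Φ_Φ y hy u (Φ y v)
  rw [S.Φ_Φ y hy, S.H_Φ y hy, map_add, map_smul, map_neg, S.G_V hy, S.H_Φ y hy] at h
  simp at h
  linarith

lemma fderiv_A_symm (S : SasakiLikeOn U G A Φ V H) {y : E} (hy : y ∈ U) (u v : E) :
    fderiv ℝ A y u v = (fderiv ℝ A y u).flip v := by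
  ext w
  have hA := (S.contDiff_A y hy).hasFDerivAt_of_infty
  simpa using fderiv_apply_eq_of_eqOn S.isOpen hy (fun x hx => S.A_symm x hx v w)
    ((hA.clm_apply_const v).clm_apply_const w) ((hA.clm_apply_const w).clm_apply_const v) u

/-- The coordinate form of `∇_u ξ = -φ u`. -/
lemma fderiv_V (S : SasakiLikeOn U G A Φ V H) {y : E} (hy : y ∈ U) (u : E) :
    fderiv ℝ V y u = -Φ y u - A y u (V y) := by
  have hΦ := (S.contDiff_Φ y hy).hasFDerivAt_of_infty
  have hV := (S.contDiff_V y hy).hasFDerivAt_of_infty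
  have hG := (S.contDiff_G y hy).hasFDerivAt_of_infty
  have h1 : Φ y (fderiv ℝ V y u) + fderiv ℝ Φ y u (V y) = 0 := by
    simpa using fderiv_apply_eq_of_eqOn S.isOpen hy (fun x hx => S.Φ_V x hx)
      (hΦ.clm_apply hV) (hasFDerivAt_const 0 y) u
  have h2 : G y (V y) (fderiv ℝ V y u) + (G y (fderiv ℝ V y u) (V y)
      + fderiv ℝ G y u (V y) (V y)) = 0 := by
    simpa using fderiv_apply_eq_of_eqOn S.isOpen hy
      (fun x hx => (S.G_V hx (V x)).trans (S.H_V x hx))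
      ((hG.clm_apply hV).clm_apply hV) (hasFDerivAt_const 1 y) u
  have h3 : H y (fderiv ℝ V y u + A y u (V y)) = 0 := by
    rw [S.fderiv_G y hy, S.G_symm y hy (V y) (fderiv ℝ V y u), S.G_symm y hy (V y),
      S.G_V hy, S.G_V hy] at h2
    rw [map_add]
    linarith
  -- Evaluating `∇_u φ` on `ξ` determines `φ (∇_u ξ)`; applying `φ` once more determines `∇_u ξ`,
  -- since `η (∇_u ξ) = 0` by `h3`.
  have h4 := S.nabla_Φ y hy u (V y)
  rw [S.Φ_V y hy, S.G_V hy, S.H_V y hy, map_zero] at h4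
  have h5 : Φ y (fderiv ℝ V y u + A y u (V y)) = u - H y u • V y := by
    rw [map_add, eq_neg_of_add_eq_zero_left h1]
    linear_combination (norm := module) (-1 : ℝ) • h4
  have h6 := congrArg (Φ y) h5
  rw [S.Φ_Φ y hy, h3, map_sub, map_smul, S.Φ_V y hy] at h6
  linear_combination (norm := module) (-1 : ℝ) • h6

/-- The coordinate form of `(∇_u η) v = -g(φ u, v)`. -/
lemma fderiv_H (S : SasakiLikeOn U G A Φ V H) {y : E} (hy : y ∈ U) (u v : E) :
    fderiv ℝ H y u v = H y (A y u v) - G y (Φ y u) v := by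
  have hV := (S.contDiff_V y hy).hasFDerivAt_of_infty
  have hG := (S.contDiff_G y hy).hasFDerivAt_of_infty
  have hH := (S.contDiff_H y hy).hasFDerivAt_of_infty
  have h : G y v (fderiv ℝ V y u) + fderiv ℝ G y u v (V y) = fderiv ℝ H y u v := by
    simpa using fderiv_apply_eq_of_eqOn S.isOpen hy (fun x hx => S.G_V hx v)
      ((hG.clm_apply_const v).clm_apply hV) (hH.clm_apply_const v) u
  rw [← h, S.fderiv_V hy, S.fderiv_G y hy, S.G_V hy, map_sub, map_neg, S.G_symm y hy (Φ y u)]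
  ring

lemma fderiv_Φ (S : SasakiLikeOn U G A Φ V H) {y : E} (hy : y ∈ U) (u v : E) :
    fderiv ℝ Φ y u v = Φ y (A y u v) - A y u (Φ y v)
      + (-G y u v • V y - H y v • u + (2 * H y u * H y v) • V y) := by
  rw [← S.nabla_Φ y hy]
  abel

/-- `R(u, v) ξ = η(v) u - η(u) v`, the Ricci identity for `∇ξ = -φ`. -/
lemma connCurvature_V (S : SasakiLikeOn U G A Φ V H) {y : E} (hy : y ∈ U) (u v : E) :
    connCurvature A y u v (V y) = H y v • u - H y u • v := by
  have hΦ := (S.contDiff_Φ y hy).hasFDerivAt_of_infty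
  have hV := (S.contDiff_V y hy).hasFDerivAt_of_infty
  have hA := (S.contDiff_A y hy).hasFDerivAt_of_infty
  have hV2 := (S.contDiff_V y hy).hasFDerivAt_fderiv_of_infty
  have key : ∀ u v, fderiv ℝ (fderiv ℝ V) y u v
      = -fderiv ℝ Φ y u v - (A y v (fderiv ℝ V y u) + fderiv ℝ A y u v (V y)) := by
    intro u v
    simpa using fderiv_apply_eq_of_eqOn S.isOpen hy (fun x hx => S.fderiv_V hx v)
      (hV2.clm_apply_const v)
      ((hΦ.clm_apply_const v).neg.sub ((hA.clm_apply_const v).clm_apply hV)) u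
  have h := (S.contDiff_V y hy).fderiv_fderiv_comm u v
  rw [key, key, S.fderiv_V hy, S.fderiv_V hy, S.fderiv_Φ hy, S.fderiv_Φ hy, S.G_symm y hy v u,
    S.A_symm y hy v u] at h
  simp only [map_sub, map_neg] at h
  rw [connCurvature, mul_right_comm 2 (H y v)] at *
  linear_combination (norm := module) (-1 : ℝ) • h

/-- `g(R(u, v) z, w)` is antisymmetric in `z`, `w`: the Ricci identity for `∇g = 0`. -/
lemma G_connCurvature_antisymm (S : SasakiLikeOn U G A Φ V H) {y : E} (hy : y ∈ U)
    (u v z w : E) :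
    G y (connCurvature A y u v z) w = -G y (connCurvature A y u v w) z := by
  have hG := (S.contDiff_G y hy).hasFDerivAt_of_infty
  have hA := (S.contDiff_A y hy).hasFDerivAt_of_infty
  -- The scalar function `x ↦ G x z w` keeps the second derivative free of nested operator spaces.
  have hf : ContDiffAt ℝ ∞ (fun x => G x z w) y :=
    ((S.contDiff_G y hy).clm_apply contDiffAt_const).clm_apply contDiffAt_const
  have key : ∀ u v, fderiv ℝ (fderiv ℝ (fun x => G x z w)) y u v
      = G y (fderiv ℝ A y u v z) w + fderiv ℝ G y u (A y v z) w
        + (G y z (fderiv ℝ A y u v w) + fderiv ℝ G y u z (A y v w)) := by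
    intro u v
    have hfd : ∀ x ∈ U, fderiv ℝ (fun x => G x z w) x v
        = G x (A x v z) w + G x z (A x v w) := fun x hx => by
      rw [← S.fderiv_G x hx, ((((S.contDiff_G x hx).hasFDerivAt_of_infty).clm_apply_const
        z).clm_apply_const w).fderiv]
      rfl
    simpa using fderiv_apply_eq_of_eqOn S.isOpen hy hfd
      (hf.hasFDerivAt_fderiv_of_infty.clm_apply_const v)
      (((hG.clm_apply ((hA.clm_apply_const v).clm_apply_const z)).clm_apply_const w).add
        ((hG.clm_apply_const z).clm_apply ((hA.clm_apply_const v).clm_apply_const w))) u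
  have h := hf.fderiv_fderiv_comm u v
  rw [key, key] at h
  simp only [S.fderiv_G y hy] at h
  rw [S.G_symm y hy _ z]
  simp only [connCurvature, map_add, map_sub, add_apply,
    sub_apply]
  linarith

/-- The first Bianchi identity. -/
lemma connCurvature_cyclic (S : SasakiLikeOn U G A Φ V H) {y : E} (hy : y ∈ U) (u v w : E) :
    connCurvature A y u v w + connCurvature A y v w u + connCurvature A y w u v = 0 := by
  have h : ∀ u v w, fderiv ℝ A y u v w = fderiv ℝ A y u w v := fun u v w => by
    rw [S.fderiv_A_symm hy]; rfl
  simp only [connCurvature]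
  rw [h u v w, h v w u, h w u v, S.A_symm y hy v w, S.A_symm y hy u w, S.A_symm y hy u v]
  abel

lemma G_connCurvature_pair_symm (S : SasakiLikeOn U G A Φ V H) {y : E} (hy : y ∈ U)
    (u v z w : E) :
    G y (connCurvature A y u v z) w = G y (connCurvature A y z w u) v := by
  have hc : ∀ a b c d, G y (connCurvature A y a b c) d + G y (connCurvature A y b c a) d
      + G y (connCurvature A y c a b) d = 0 := fun a b c d => by
    have := congrArg (fun t => G y t d) (S.connCurvature_cyclic hy a b c)
    simpa using this
  have ha : ∀ a b c d, G y (connCurvature A y a b c) d = -G y (connCurvature A y b a c) d :=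
    fun a b c d => by rw [connCurvature_antisymm A y a b]; simp
  have hs := S.G_connCurvature_antisymm hy
  linarith [hc u v z w, hc v z w u, hc z w u v, hc w u v z, hs u v z w, hs v z u w, hs z w u v,
    ha z u v w, hs u z v w, ha w v z u, hs v w z u, hs w u z v]

/-- `R(v, ξ) z = η(z) v - g(v, z) ξ`, from `connCurvature_V` and the pair symmetry of `R`. -/
lemma connCurvature_snd_V (S : SasakiLikeOn U G A Φ V H) {y : E} (hy : y ∈ U) (v z : E) :
    connCurvature A y v (V y) z = H y z • v - G y v z • V y := by
  rw [← sub_eq_zero]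
  refine S.G_nondeg y hy _ fun w => ?_
  have h : G y (connCurvature A y v (V y) z) w = H y z * G y v w - H y w * G y v z := by
    rw [S.G_connCurvature_pair_symm hy, S.G_connCurvature_antisymm hy, S.connCurvature_V hy]
    simp only [map_sub, map_smul, sub_apply, smul_apply,
      smul_eq_mul]
    rw [S.G_symm y hy w v, S.G_symm y hy z v]
    ring
  rw [map_sub, sub_apply, h]
  simp only [map_sub, map_smul, sub_apply, smul_apply,
      smul_eq_mul]
  rw [S.G_symm y hy (V y) w, S.G_V hy]
  ring

/-- The commutator of `R(u, v)` with `φ`: the Ricci identity for the prescribed `∇φ`. -/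
lemma connCurvature_Φ (S : SasakiLikeOn U G A Φ V H) {y : E} (hy : y ∈ U) (u v z : E) :
    connCurvature A y u v (Φ y z) - Φ y (connCurvature A y u v z)
      = (G y v z - 2 * H y v * H y z) • Φ y u - (G y u z - 2 * H y u * H y z) • Φ y v
        + G y (Φ y u) z • (v - (2 * H y v) • V y) - G y (Φ y v) z • (u - (2 * H y u) • V y) := by
  have hΦ := (S.contDiff_Φ y hy).hasFDerivAt_of_infty
  have hV := (S.contDiff_V y hy).hasFDerivAt_of_infty
  have hA := (S.contDiff_A y hy).hasFDerivAt_of_infty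
  have hG := (S.contDiff_G y hy).hasFDerivAt_of_infty
  have hH := (S.contDiff_H y hy).hasFDerivAt_of_infty
  have hf : ContDiffAt ℝ ∞ (fun x => Φ x z) y := (S.contDiff_Φ y hy).clm_apply contDiffAt_const
  have key : ∀ u v, fderiv ℝ (fderiv ℝ (fun x => Φ x z)) y u v
      = Φ y (fderiv ℝ A y u v z) + fderiv ℝ Φ y u (A y v z)
        - (A y v (fderiv ℝ Φ y u z) + fderiv ℝ A y u v (Φ y z))
        + ((-G y v z • fderiv ℝ V y u - fderiv ℝ G y u v z • V y) - fderiv ℝ H y u z • v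
          + ((2 * H y v * H y z) • fderiv ℝ V y u
            + (2 * H y v * fderiv ℝ H y u z + H y z * (2 * fderiv ℝ H y u v)) • V y)) := by
    intro u v
    have hfd : ∀ x ∈ U, fderiv ℝ (fun x => Φ x z) x v = Φ x (A x v z) - A x v (Φ x z)
        + (-G x v z • V x - H x z • v + (2 * H x v * H x z) • V x) := fun x hx => by
      rw [((S.contDiff_Φ x hx).hasFDerivAt_of_infty.clm_apply_const z).fderiv]
      simpa using S.fderiv_Φ hx v z
    have := fderiv_apply_eq_of_eqOn S.isOpen hy hfd
      (hf.hasFDerivAt_fderiv_of_infty.clm_apply_const v)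
      (((hΦ.clm_apply ((hA.clm_apply_const v).clm_apply_const z)).sub
        ((hA.clm_apply_const v).clm_apply (hΦ.clm_apply_const z))).add
        ((((((hG.clm_apply_const v).clm_apply_const z).neg).smul hV).sub
          ((hH.clm_apply_const z).smul_const v)).add
          ((((hH.clm_apply_const v).const_mul 2).mul (hH.clm_apply_const z)).smul hV))) u
    simpa [sub_eq_add_neg] using this
  have h := hf.fderiv_fderiv_comm u v
  rw [key, key] at h
  simp only [S.fderiv_G y hy, S.fderiv_Φ hy, S.fderiv_V hy, S.fderiv_H hy] at h
  simp only [connCurvature, map_add, map_sub, map_smul] at h ⊢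
  rw [S.A_symm y hy v u, S.G_symm y hy v (A y u z), S.G_symm y hy u (A y v z),
    S.G_Φ_comm hy v u, S.G_symm y hy v (Φ y u)] at h
  linear_combination (norm := module) (-1 : ℝ) • h

end SasakiLikeOn

/-! ### The second Bianchi identity and `𝓛_ξ R` -/

/-- The endomorphism `u ↦ R(u, v) z`, whose trace is the Ricci tensor. -/
def connCurvatureEnd (A : E → E →L[ℝ] E →L[ℝ] E) (y v z : E) : E →L[ℝ] E :=
  ((fderiv ℝ A y).flip v).flip z - (fderiv ℝ A y v).flip z + (A y).flip (A y v z)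
    - (A y v).comp ((A y).flip z)

lemma connCurvatureEnd_apply (A : E → E →L[ℝ] E →L[ℝ] E) (y u v z : E) :
    connCurvatureEnd A y v z u = connCurvature A y u v z := rfl

lemma connCurvature_snd_neg (A : E → E →L[ℝ] E →L[ℝ] E) (y u v z : E) :
    connCurvature A y u (-v) z = -connCurvature A y u v z := by
  rw [connCurvature_antisymm, connCurvature_antisymm A y u v, ← connCurvatureEnd_apply, map_neg,
    connCurvatureEnd_apply]

lemma connCurvature_snd_sub (A : E → E →L[ℝ] E →L[ℝ] E) (y u v w z : E) :
    connCurvature A y u (v - w) z = connCurvature A y u v z - connCurvature A y u w z := by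
  rw [connCurvature_antisymm, connCurvature_antisymm A y u v, connCurvature_antisymm A y u w,
    ← connCurvatureEnd_apply, map_sub, connCurvatureEnd_apply, connCurvatureEnd_apply]
  abel

/-- The derivative in the direction `w` of `x ↦ R_x(u, v) z` for constant `u`, `v`, `z`. The second
derivatives of `A` enter through the map `x ↦ A x z`, which uses the symmetry of `A`. -/
def connCurvatureDeriv (A : E → E →L[ℝ] E →L[ℝ] E) (y w u v z : E) : E :=
  fderiv ℝ (fderiv ℝ (fun x => A x z)) y w u v - fderiv ℝ (fderiv ℝ (fun x => A x z)) y w v u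
    + (A y u (fderiv ℝ A y w z v) + fderiv ℝ A y w u (A y z v))
    - (A y v (fderiv ℝ A y w z u) + fderiv ℝ A y w v (A y z u))

namespace SasakiLikeOn

variable {U : Set E} {G : E → E →L[ℝ] E →L[ℝ] ℝ} {A : E → E →L[ℝ] E →L[ℝ] E}
    {Φ : E → E →L[ℝ] E} {V : E → E} {H : E → E →L[ℝ] ℝ}

/-- The derivative of `x ↦ R_x(u, q(x)) z` for a variable vector field `q`. -/
lemma exists_hasFDerivAt_connCurvature (S : SasakiLikeOn U G A Φ V H) {y : E} (hy : y ∈ U)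
    (u z : E) {q : E → E} {q' : E →L[ℝ] E} (hq : HasFDerivAt q q' y) :
    ∃ D : E →L[ℝ] E, HasFDerivAt (fun x => connCurvature A x u (q x) z) D y ∧
      ∀ w, D w = connCurvatureDeriv A y w u (q y) z + connCurvature A y u (q' w) z := by
  have hA := (S.contDiff_A y hy).hasFDerivAt_of_infty
  have hB : ∀ x ∈ U, ContDiffAt ℝ ∞ (fun x => A x z) x := fun x hx =>
    (S.contDiff_A x hx).clm_apply contDiffAt_const
  have hBA : ∀ x ∈ U, ∀ w v, fderiv ℝ (fun x => A x z) x w v = fderiv ℝ A x w v z := by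
    intro x hx w v
    rw [(((S.contDiff_A x hx).hasFDerivAt_of_infty).clm_apply_const z).fderiv,
      S.fderiv_A_symm hx w v]
    rfl
  have hB1 := (hB y hy).hasFDerivAt_of_infty
  have hB2 := (hB y hy).hasFDerivAt_fderiv_of_infty
  have h := (((hB2.clm_apply_const u).clm_apply hq).sub ((hB2.clm_apply hq).clm_apply_const u)).add
    ((hA.clm_apply_const u).clm_apply (hB1.clm_apply hq)) |>.sub
    ((hA.clm_apply hq).clm_apply (hB1.clm_apply_const u))
  refine ⟨_, h.congr_of_eventuallyEq ?_, fun w => ?_⟩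
  · filter_upwards [S.isOpen.mem_nhds hy] with x hx
    simp [connCurvature, hBA x hx, S.A_symm x hx z]
  · simp only [connCurvature, connCurvatureDeriv, ← hBA y hy]
    simp [hBA y hy, S.A_symm y hy z, S.fderiv_A_symm hy w z]
    module

lemma fderiv_connCurvature (S : SasakiLikeOn U G A Φ V H) {y : E} (hy : y ∈ U) (u v z : E) :
    DifferentiableAt ℝ (fun x => connCurvature A x u v z) y ∧
    ∀ w, fderiv ℝ (fun x => connCurvature A x u v z) y w = connCurvatureDeriv A y w u v z := by
  obtain ⟨D, hD, h⟩ := S.exists_hasFDerivAt_connCurvature hy u z (hasFDerivAt_const v y)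
  refine ⟨hD.differentiableAt, fun w => ?_⟩
  rw [hD.fderiv, h]
  rw [zero_apply, connCurvature_antisymm, ← connCurvatureEnd_apply, map_zero, neg_zero, add_zero]

/-- The second Bianchi identity. -/
lemma connCurvatureDeriv_cyclic (S : SasakiLikeOn U G A Φ V H) {y : E} (hy : y ∈ U)
    (u v w z : E) :
    connCurvatureDeriv A y w u v z + A y w (connCurvature A y u v z)
        - connCurvature A y u v (A y w z)
      + (connCurvatureDeriv A y u v w z + A y u (connCurvature A y v w z)
        - connCurvature A y v w (A y u z))
      + (connCurvatureDeriv A y v w u z + A y v (connCurvature A y w u z)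
        - connCurvature A y w u (A y v z)) = 0 := by
  have hB : ContDiffAt ℝ ∞ (fun x => A x z) y := (S.contDiff_A y hy).clm_apply contDiffAt_const
  have h : ∀ u v, fderiv ℝ A y u v z = fderiv ℝ A y u z v := fun u v => by
    rw [S.fderiv_A_symm hy]; rfl
  simp only [connCurvatureDeriv, connCurvature, map_add, map_sub, h, S.A_symm y hy z]
  rw [hB.fderiv_fderiv_comm w u, hB.fderiv_fderiv_comm w v, hB.fderiv_fderiv_comm u v]
  module

lemma connCurvatureDeriv_antisymm (A : E → E →L[ℝ] E →L[ℝ] E) (y w u v z : E) :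
    connCurvatureDeriv A y w u v z = -connCurvatureDeriv A y w v u z := by
  simp only [connCurvatureDeriv]
  abel

/-- The derivative of `R(v, ξ) z = η(z) v - g(v, z) ξ`. -/
lemma connCurvatureDeriv_V (S : SasakiLikeOn U G A Φ V H) {y : E} (hy : y ∈ U) (u v z : E) :
    connCurvatureDeriv A y u v (V y) z = (H y (A y u z) - G y (Φ y u) z) • v
      - (G y (A y u v) z + G y v (A y u z)) • V y + G y v z • (Φ y u + A y u (V y))
      + connCurvature A y v (Φ y u) z + connCurvature A y v (A y u (V y)) z := by
  have hV := (S.contDiff_V y hy).hasFDerivAt_of_infty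
  have hG := (S.contDiff_G y hy).hasFDerivAt_of_infty
  have hH := (S.contDiff_H y hy).hasFDerivAt_of_infty
  obtain ⟨D, hD, h⟩ := S.exists_hasFDerivAt_connCurvature hy v z hV
  have h' := fderiv_apply_eq_of_eqOn S.isOpen hy (fun x hx => S.connCurvature_snd_V hx v z) hD
    (((hH.clm_apply_const z).smul_const v).sub
      (((hG.clm_apply_const v).clm_apply_const z).smul hV)) u
  rw [h] at h'
  simp [S.fderiv_H hy, S.fderiv_V hy, S.fderiv_G y hy, connCurvature_snd_sub,
    connCurvature_snd_neg] at h'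
  linear_combination (norm := module) h'

/-- `(𝓛_ξ R)(u, v) z`, computed from the second Bianchi identity. -/
lemma lieDeriv_connCurvature (S : SasakiLikeOn U G A Φ V H) {y : E} (hy : y ∈ U) (u v z : E) :
    connCurvatureDeriv A y (V y) u v z + A y (V y) (connCurvature A y u v z)
        - connCurvature A y u v (A y (V y) z) - connCurvature A y (A y (V y) u) v z
        - connCurvature A y u (A y (V y) v) z
      = connCurvature A y (Φ y u) v z + connCurvature A y u (Φ y v) z
        + G y (Φ y u) z • v - G y (Φ y v) z • u - G y v z • Φ y u + G y u z • Φ y v := by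
  have h := S.connCurvatureDeriv_cyclic hy u v (V y) z
  rw [connCurvatureDeriv_antisymm A y v (V y) u z, S.connCurvatureDeriv_V hy,
    S.connCurvatureDeriv_V hy, connCurvature_antisymm A y (V y) u,
    connCurvature_antisymm A y (V y) u, S.connCurvature_snd_V hy, S.connCurvature_snd_V hy,
    S.connCurvature_snd_V hy, S.connCurvature_snd_V hy, connCurvature_antisymm A y v,
    connCurvature_antisymm A y v, S.A_symm y hy v u, S.A_symm y hy u (V y),
    S.A_symm y hy v (V y)] at h
  simp only [map_sub, map_neg, map_smul] at h ⊢
  linear_combination (norm := skip) h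
  rw [S.A_symm y hy u (V y), S.A_symm y hy v (V y), S.A_symm y hy v u]
  module

end SasakiLikeOn

/-! ### The Ricci tensor and `𝓛_ξ ρ` -/

/-- The Ricci tensor `ρ(v, z) = tr (u ↦ R(u, v) z)`. -/
def connRicci (A : E → E →L[ℝ] E →L[ℝ] E) (y v z : E) : ℝ :=
  LinearMap.trace ℝ E (connCurvatureEnd A y v z)

lemma connRicci_def (A : E → E →L[ℝ] E →L[ℝ] E) (y v z : E) :
    connRicci A y v z = LinearMap.trace ℝ E (connCurvatureEnd A y v z) := rfl

namespace SasakiLikeOn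

variable {U : Set E} {G : E → E →L[ℝ] E →L[ℝ] ℝ} {A : E → E →L[ℝ] E →L[ℝ] E}
    {Φ : E → E →L[ℝ] E} {V : E → E} {H : E → E →L[ℝ] ℝ}

/-- The derivative of the Ricci tensor is the trace of the derivative of the curvature; `L` is any
linear map which represents the latter. -/
lemma hasFDerivAt_connRicci [FiniteDimensional ℝ E]
    (S : SasakiLikeOn U G A Φ V H) {y : E} (hy : y ∈ U)
    (w v z : E) (L : E →ₗ[ℝ] E) (hL : ∀ u, L u = connCurvatureDeriv A y w u v z) :
    ∃ D : E →L[ℝ] ℝ, HasFDerivAt (fun x => connRicci A x v z) D y ∧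
      D w = LinearMap.trace ℝ E L := by
  let b := Module.finBasis ℝ E
  have htr : ∀ f : E →ₗ[ℝ] E, LinearMap.trace ℝ E f
      = ∑ i, (b.coord i).toContinuousLinearMap (f (b i)) := fun f => by
    rw [LinearMap.trace_eq_matrix_trace ℝ b]
    simp [Matrix.trace, LinearMap.toMatrix_apply]
  simp only [connRicci, htr]
  refine ⟨_, HasFDerivAt.fun_sum fun i _ => (b.coord i).toContinuousLinearMap.hasFDerivAt.comp y
    (S.fderiv_connCurvature hy (b i) v z).1.hasFDerivAt, ?_⟩
  simp [hL, (S.fderiv_connCurvature hy (b _) v z).2]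

lemma trace_Φ [FiniteDimensional ℝ E] (S : SasakiLikeOn U G A Φ V H) {y : E} (hy : y ∈ U) :
    LinearMap.trace ℝ E (Φ y) = 0 := by
  refine LinearMap.trace_eq_zero_of_cube_eq_neg _ fun u => ?_
  simp [S.Φ_Φ y hy, S.Φ_V y hy]

/-- `ρ(ξ, ξ) = d - 1` in dimension `d`. -/
lemma connRicci_V_V [FiniteDimensional ℝ E] (S : SasakiLikeOn U G A Φ V H) {y : E} (hy : y ∈ U) :
    connRicci A y (V y) (V y) = Module.finrank ℝ E - 1 := by
  have : (connCurvatureEnd A y (V y) (V y) : E →ₗ[ℝ] E)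
      = LinearMap.id - LinearMap.smulRight (H y : E →ₗ[ℝ] ℝ) (V y) := by
    ext u
    simp [connCurvatureEnd_apply, S.connCurvature_V hy, S.H_V y hy]
  rw [connRicci, this, map_sub, LinearMap.trace_id, LinearMap.trace_smulRight]
  simp [S.H_V y hy]

/-- `tr (u ↦ R(φ u, v) z) = ρ(v, φ z) + (d - 2) g(φ v, z)` in dimension `d`, from the Ricci
identity for `φ` and `tr φ = 0`. -/
lemma trace_connCurvatureEnd_comp_Φ [FiniteDimensional ℝ E] (S : SasakiLikeOn U G A Φ V H)
    {y : E} (hy : y ∈ U) (v z : E) :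
    LinearMap.trace ℝ E ((connCurvatureEnd A y v z : E →ₗ[ℝ] E) ∘ₗ (Φ y : E →ₗ[ℝ] E))
      = connRicci A y v (Φ y z) + (Module.finrank ℝ E - 2) * G y (Φ y v) z := by
  have h : (Φ y : E →ₗ[ℝ] E) ∘ₗ (connCurvatureEnd A y v z : E →ₗ[ℝ] E)
      = (connCurvatureEnd A y v (Φ y z) : E →ₗ[ℝ] E)
        - (G y v z - 2 * H y v * H y z) • (Φ y : E →ₗ[ℝ] E)
        + LinearMap.smulRight ((G y z : E →ₗ[ℝ] ℝ) - (2 * H y z) • (H y : E →ₗ[ℝ] ℝ)) (Φ y v)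
        - LinearMap.smulRight (G y (Φ y z) : E →ₗ[ℝ] ℝ) (v - (2 * H y v) • V y)
        + G y (Φ y v) z • (LinearMap.id - (2 : ℝ) • LinearMap.smulRight (H y : E →ₗ[ℝ] ℝ) (V y)) := by
    ext u
    have := S.connCurvature_Φ hy u v z
    simp [connCurvatureEnd_apply]
    rw [S.G_symm y hy z u, S.G_Φ_comm hy z u, S.G_symm y hy z]
    linear_combination (norm := module) (-1 : ℝ) • this
  rw [LinearMap.trace_comp_comm', h]
  simp only [map_add, map_sub, map_smul, LinearMap.trace_smulRight, LinearMap.trace_id,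
    S.trace_Φ hy]
  simp [S.H_Φ y hy, S.G_V hy, S.H_V y hy, connRicci]
  rw [S.G_Φ_comm hy z v, S.G_symm y hy z (Φ y v)]
  ring

/-- `(𝓛_ξ ρ)(v, z) = 0`: the derivative of `ρ(v, z)` along `ξ` is `-ρ(∇'_v ξ, z) - ρ(v, ∇'_z ξ)`,
where the ordinary derivative of `ξ` in the direction `u` is `∇'_u ξ = -φ u - A ξ u`. -/
lemma lieDeriv_connRicci [FiniteDimensional ℝ E] (S : SasakiLikeOn U G A Φ V H) {y : E}
    (hy : y ∈ U) (v z : E) :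
    ∃ D : E →L[ℝ] ℝ, HasFDerivAt (fun x => connRicci A x v z) D y ∧
      D (V y) = connRicci A y v (A y (V y) z) + connRicci A y (A y (V y) v) z
        + connRicci A y (Φ y v) z + connRicci A y v (Φ y z) := by
  -- The trace of the commutator of `R v z` and `B` vanishes.
  let R (v z : E) : E →ₗ[ℝ] E := connCurvatureEnd A y v z
  let B : E →ₗ[ℝ] E := A y (V y)
  obtain ⟨D, hD, h⟩ := S.hasFDerivAt_connRicci hy (V y) v z
    (R v (B z) + R (B v) z + (R v z ∘ₗ B - B ∘ₗ R v z) + R v z ∘ₗ (Φ y : E →ₗ[ℝ] E)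
      + R (Φ y v) z + LinearMap.smulRight (G y (Φ y z) : E →ₗ[ℝ] ℝ) v
      - G y (Φ y v) z • LinearMap.id - G y v z • (Φ y : E →ₗ[ℝ] E)
      + LinearMap.smulRight (G y z : E →ₗ[ℝ] ℝ) (Φ y v)) fun u => by
    have := S.lieDeriv_connCurvature hy u v z
    simp [R, B, connCurvatureEnd_apply]
    rw [S.G_symm y hy z u, S.G_Φ_comm hy z u, S.G_symm y hy z]
    linear_combination (norm := module) (-1 : ℝ) • this
  refine ⟨D, hD, ?_⟩
  rw [h]
  simp only [map_add, map_sub, map_smul, LinearMap.trace_smulRight, LinearMap.trace_id,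
    S.trace_Φ hy, LinearMap.trace_comp_comm' B, R, S.trace_connCurvatureEnd_comp_Φ hy]
  simp only [B, ContinuousLinearMap.coe_coe]
  rw [S.G_Φ_comm hy z, S.G_symm y hy z]
  simp [← connRicci_def]
  ring

/-- An Einstein-like Ricci tensor equals `(d - 1) η ⊗ η` in dimension `d`: the conditions `𝓛_ξ ρ = 0`
and `ρ(ξ, ξ) = d - 1` determine it. -/
theorem connRicci_eq_of_einsteinLike [FiniteDimensional ℝ E] (S : SasakiLikeOn U G A Φ V H)
    {a b c : ℝ} (h : ∀ y ∈ U, ∀ v z, connRicci A y v z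
      = a * G y v z + b * (G y v (Φ y z) + H y v * H y z) + c * (H y v * H y z))
    {y : E} (hy : y ∈ U) (v z : E) :
    connRicci A y v z = (Module.finrank ℝ E - 1) * (H y v * H y z) := by
  have hsum : a + b + c = Module.finrank ℝ E - 1 := by
    rw [← S.connRicci_V_V hy, h y hy]
    simp [S.G_V hy, S.H_V y hy, S.Φ_V y hy]
  -- `𝓛_ξ ρ = 0`, evaluated on `ρ = a g + b g̃ + c η ⊗ η`.
  have key : ∀ v z, a * G y v (Φ y z) = b * (G y v z - H y v * H y z) := by
    intro v z
    obtain ⟨D, hD, hDV⟩ := S.lieDeriv_connRicci hy v z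
    have hG := (S.contDiff_G y hy).hasFDerivAt_of_infty
    have hH := (S.contDiff_H y hy).hasFDerivAt_of_infty
    have hΦ := (S.contDiff_Φ y hy).hasFDerivAt_of_infty
    have hGv := hG.clm_apply_const v
    have hHH := (hH.clm_apply_const v).mul (hH.clm_apply_const z)
    have h' := fderiv_apply_eq_of_eqOn S.isOpen hy (fun x hx => h x hx v z) hD
      ((((hGv.clm_apply_const z).const_mul a).add
        (((hGv.clm_apply (hΦ.clm_apply_const z)).add hHH).const_mul b)).add (hHH.const_mul c))
      (V y)
    rw [hDV] at h'
    simp [h y hy, S.fderiv_G y hy, S.fderiv_Φ hy, S.fderiv_H hy, S.Φ_Φ y hy, S.H_Φ y hy,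
      S.Φ_V y hy, S.H_V y hy, S.G_V hy] at h'
    rw [S.G_Φ_Φ y hy, S.G_Φ_comm hy v z, S.G_symm y hy (V y) z, S.G_V hy] at h'
    linear_combination h' / 2
  have h1 := key v (Φ y z)
  rw [S.Φ_Φ y hy, S.H_Φ y hy] at h1
  simp [S.G_V hy] at h1
  rw [h y hy]
  linear_combination (H y v * H y z) * hsum - h1

end SasakiLikeOn
end LocalStructure

/-! ### The Levi-Civita connection of a metric in coordinates -/

namespace LocalGeometry

variable {m : ℕ} {U : Set (EuclideanSpace ℝ (Fin m))}
  {G : EuclideanSpace ℝ (Fin m) →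
      (EuclideanSpace ℝ (Fin m) →L[ℝ] EuclideanSpace ℝ (Fin m) →L[ℝ] ℝ)}
  {Φ : EuclideanSpace ℝ (Fin m) → (EuclideanSpace ℝ (Fin m) →L[ℝ] EuclideanSpace ℝ (Fin m))}
  {V : EuclideanSpace ℝ (Fin m) → EuclideanSpace ℝ (Fin m)}
  {H : EuclideanSpace ℝ (Fin m) → (EuclideanSpace ℝ (Fin m) →L[ℝ] ℝ)}

/-- The continuous bilinear map `(u, v) ↦ L (½ (D u v + D v u - T u v))`. -/
def halfSumCLM {E N : Type*} [NormedAddCommGroup E] [NormedSpace ℝ E] [NormedAddCommGroup N]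
    [NormedSpace ℝ N] (L : N →L[ℝ] E) (D T : E →L[ℝ] E →L[ℝ] N) : E →L[ℝ] E →L[ℝ] E :=
  (ContinuousLinearMap.compL ℝ E N E L).comp ((1 / 2 : ℝ) • (D + D.flip - T))

/-- The Christoffel map as a continuous bilinear map. -/
def christoffelCLM (G : EuclideanSpace ℝ (Fin m) →
      (EuclideanSpace ℝ (Fin m) →L[ℝ] EuclideanSpace ℝ (Fin m) →L[ℝ] ℝ))
    (y : EuclideanSpace ℝ (Fin m)) :
    EuclideanSpace ℝ (Fin m) →L[ℝ] EuclideanSpace ℝ (Fin m) →L[ℝ] EuclideanSpace ℝ (Fin m) :=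
  halfSumCLM (G y).inverse (fderiv ℝ G y)
    ((ContinuousLinearMap.flipₗᵢ ℝ (EuclideanSpace ℝ (Fin m)) (EuclideanSpace ℝ (Fin m))
      ℝ).toContinuousLinearEquiv.toContinuousLinearMap.comp (fderiv ℝ G y).flip)

lemma christoffelCLM_apply (y u v : EuclideanSpace ℝ (Fin m)) :
    christoffelCLM G y u v = christoffel G y u v := rfl

lemma isInvertible_of_nondeg {L : EuclideanSpace ℝ (Fin m) →L[ℝ] EuclideanSpace ℝ (Fin m) →L[ℝ] ℝ}
    (h : ∀ u, (∀ v, L u v = 0) → u = 0) : L.IsInvertible := by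
  have hinj : Function.Injective L.toLinearMap := by
    rw [← LinearMap.ker_eq_bot, LinearMap.ker_eq_bot']
    intro u hu
    exact h u fun v => by simpa using congrArg (fun t => t v) hu
  have hdim : Module.finrank ℝ (EuclideanSpace ℝ (Fin m))
      = Module.finrank ℝ (EuclideanSpace ℝ (Fin m) →L[ℝ] ℝ) := by
    rw [← LinearMap.toContinuousLinearMap.finrank_eq, Module.finrank_linearMap_self]
  exact ⟨(LinearEquiv.ofInjectiveOfFinrankEq _ hinj hdim).toContinuousLinearEquiv, by ext; rfl⟩

/-- The Koszul formula. -/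
lemma apply_christoffel {y : EuclideanSpace ℝ (Fin m)}
    (h : ∀ u, (∀ v, G y u v = 0) → u = 0) (u v w : EuclideanSpace ℝ (Fin m)) :
    G y (christoffel G y u v) w
      = 1 / 2 * (fderiv ℝ G y u v w + fderiv ℝ G y v u w - fderiv ℝ G y w u v) := by
  rw [christoffel, (isInvertible_of_nondeg h).self_apply_inverse]
  simp

lemma contDiffAt_christoffelCLM (hU : IsOpen U) (hG : ∀ y ∈ U, ContDiffAt ℝ ∞ G y)
    (h : ∀ y ∈ U, ∀ u, (∀ v, G y u v = 0) → u = 0) {y : EuclideanSpace ℝ (Fin m)} (hy : y ∈ U) :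
    ContDiffAt ℝ ∞ (christoffelCLM G) y := by
  refine contDiffAt_of_forall_clm_apply hU (fun y hy u => ?_) hy
  refine contDiffAt_of_forall_clm_apply hU (fun y hy v => ?_) hy
  have hc : ∀ y ∈ U, ∀ u v, ContDiffAt ℝ ∞ (fun x => fderiv ℝ G x u v) y := fun y hy u v =>
    (hG y hy).fderiv_clm_apply_of_infty u v
  have hi : ContDiffAt ℝ ∞ (fun x => (G x).inverse) y :=
    ((isInvertible_of_nondeg (h y hy)).contDiffAt_map_inverse).comp y (hG y hy)
  refine hi.clm_apply ((contDiffAt_const (c := (1 / 2 : ℝ))).smul (((hc y hy u v).add (hc y hy v u)).sub ?_))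
  exact contDiffAt_of_forall_clm_apply hU
    (fun y hy w => (hc y hy w u).clm_apply contDiffAt_const) hy

/-- The Christoffel map of the metric is torsion-free and metric, as `SasakiLikeOn` requires. -/
lemma sasakiLikeOn (hU : IsOpen U) (hG : ∀ y ∈ U, ContDiffAt ℝ ∞ G y)
    (hΦ : ∀ y ∈ U, ContDiffAt ℝ ∞ Φ y) (hV : ∀ y ∈ U, ContDiffAt ℝ ∞ V y)
    (hH : ∀ y ∈ U, ContDiffAt ℝ ∞ H y)
    (G_symm : ∀ y ∈ U, ∀ u v, G y u v = G y v u)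
    (G_nondeg : ∀ y ∈ U, ∀ u, (∀ v, G y u v = 0) → u = 0)
    (Φ_V : ∀ y ∈ U, Φ y (V y) = 0) (Φ_Φ : ∀ y ∈ U, ∀ u, Φ y (Φ y u) = -u + H y u • V y)
    (H_Φ : ∀ y ∈ U, ∀ u, H y (Φ y u) = 0) (H_V : ∀ y ∈ U, H y (V y) = 1)
    (G_Φ_Φ : ∀ y ∈ U, ∀ u v, G y (Φ y u) (Φ y v) = -G y u v + H y u * H y v)
    (h : ∀ y ∈ U, ∀ u v, nablaEnd G Φ y u v
      = -G y u v • V y - H y v • u + (2 * H y u * H y v) • V y) :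
    SasakiLikeOn U G (christoffelCLM G) Φ V H := by
  have hs : ∀ y ∈ U, ∀ u v w, fderiv ℝ G y u v w = fderiv ℝ G y u w v := fun y hy u v w => by
    have hD := (hG y hy).hasFDerivAt_of_infty
    simpa using fderiv_apply_eq_of_eqOn hU hy (fun x hx => G_symm x hx v w)
      ((hD.clm_apply_const v).clm_apply_const w) ((hD.clm_apply_const w).clm_apply_const v) u
  refine ⟨hU, hG, fun y hy => contDiffAt_christoffelCLM hU hG G_nondeg hy, hΦ, hV, hH, G_symm,
    G_nondeg, fun y hy u v => ?_, fun y hy u v w => ?_, Φ_V, Φ_Φ, H_Φ, H_V, G_Φ_Φ, h⟩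
  · rw [← sub_eq_zero]
    refine G_nondeg y hy _ fun w => ?_
    rw [map_sub, sub_apply, christoffelCLM_apply, christoffelCLM_apply,
      apply_christoffel (G_nondeg y hy), apply_christoffel (G_nondeg y hy), hs y hy w u v]
    ring
  · rw [G_symm y hy v, christoffelCLM_apply, christoffelCLM_apply,
      apply_christoffel (G_nondeg y hy), apply_christoffel (G_nondeg y hy), hs y hy u w v,
      hs y hy w u v, hs y hy v u w]
    ring

/-- The coordinate sum which defines `LocalGeometry.ricci` is the trace `connRicci`. -/
lemma ricci_eq_connRicci (hA : ∀ y ∈ U, ContDiffAt ℝ ∞ (christoffelCLM G) y)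
    {y : EuclideanSpace ℝ (Fin m)} (hy : y ∈ U) (v w : EuclideanSpace ℝ (Fin m)) :
    ricci G y v w = connRicci (christoffelCLM G) y v w := by
  have hc : ∀ u, connCurvature (christoffelCLM G) y u v w = curvature G y u v w := fun u => by
    have hD := (hA y hy).hasFDerivAt_of_infty
    have hf : ∀ u v, fderiv ℝ (fun z => christoffel G z v w) y u
        = fderiv ℝ (christoffelCLM G) y u v w := fun u v => by
      simp only [← christoffelCLM_apply]
      rw [((hD.clm_apply_const v).clm_apply_const w).fderiv]
      rfl
    rw [curvature, hf, hf]
    rfl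
  rw [connRicci_def, LinearMap.trace_eq_matrix_trace ℝ (EuclideanSpace.basisFun (Fin m) ℝ).toBasis]
  simp [ricci, Matrix.trace, LinearMap.toMatrix_apply, connCurvatureEnd_apply, hc]

end LocalGeometry

namespace SasakiLikeOn

variable {m : ℕ} {U : Set (EuclideanSpace ℝ (Fin m))}
  {G : EuclideanSpace ℝ (Fin m) →
      (EuclideanSpace ℝ (Fin m) →L[ℝ] EuclideanSpace ℝ (Fin m) →L[ℝ] ℝ)}
  {A : EuclideanSpace ℝ (Fin m) → (EuclideanSpace ℝ (Fin m) →L[ℝ]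
      EuclideanSpace ℝ (Fin m) →L[ℝ] EuclideanSpace ℝ (Fin m))}
  {Φ : EuclideanSpace ℝ (Fin m) → (EuclideanSpace ℝ (Fin m) →L[ℝ] EuclideanSpace ℝ (Fin m))}
  {V : EuclideanSpace ℝ (Fin m) → EuclideanSpace ℝ (Fin m)}
  {H : EuclideanSpace ℝ (Fin m) → (EuclideanSpace ℝ (Fin m) →L[ℝ] ℝ)}

/-- `(𝓛_ξ g)(u, w) = -2 g(u, φ w)`, because `∇ξ = -φ`. -/
lemma lieMetric_V (S : SasakiLikeOn U G A Φ V H) {y : EuclideanSpace ℝ (Fin m)} (hy : y ∈ U)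
    (u w : EuclideanSpace ℝ (Fin m)) :
    LocalGeometry.lieMetric V G y u w = -2 * G y u (Φ y w) := by
  rw [LocalGeometry.lieMetric, S.fderiv_G y hy, S.fderiv_V hy, S.fderiv_V hy, S.A_symm y hy u,
    S.A_symm y hy w]
  simp only [map_sub, map_neg, sub_apply, neg_apply, S.G_Φ_comm hy u]
  ring

end SasakiLikeOn

/-! ### Passage to charts -/

lemma OpenPartialHomeomorph.mdifferentiable_of_mem_maximalAtlas {m : ℕ} {M : Type*}
    [TopologicalSpace M] [ChartedSpace (EuclideanSpace ℝ (Fin m)) M]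
    {e : OpenPartialHomeomorph M (EuclideanSpace ℝ (Fin m))}
    (he : e ∈ IsManifold.maximalAtlas (𝓡 m) ∞ M) : e.MDifferentiable (𝓡 m) (𝓡 m) :=
  ⟨(contMDiffOn_of_mem_maximalAtlas he).mdifferentiableOn (by simp),
    (contMDiffOn_symm_of_mem_maximalAtlas he).mdifferentiableOn (by simp)⟩

namespace AlmostContactBMetric

variable {n : ℕ} {M : Type*} [TopologicalSpace M]
  [ChartedSpace (EuclideanSpace ℝ (Fin (2 * n + 1))) M]
  {e : OpenPartialHomeomorph M (EuclideanSpace ℝ (Fin (2 * n + 1)))}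

/-- The differential of the inverse of the chart `e`. Its domain is `ℝ²ⁿ⁺¹` itself instead of the
tangent space of `ℝ²ⁿ⁺¹` at `y`. -/
def chartSymmDeriv (e : OpenPartialHomeomorph M (EuclideanSpace ℝ (Fin (2 * n + 1))))
    (y : EuclideanSpace ℝ (Fin (2 * n + 1))) :
    EuclideanSpace ℝ (Fin (2 * n + 1)) →L[ℝ] TangentSpace (𝓡 (2 * n + 1)) (e.symm y) :=
  mfderiv (𝓡 (2 * n + 1)) (𝓡 (2 * n + 1)) e.symm y

lemma mfderiv_chartSymmDeriv (he : e ∈ IsManifold.maximalAtlas (𝓡 (2 * n + 1)) ∞ M)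
    {y : EuclideanSpace ℝ (Fin (2 * n + 1))} (hy : y ∈ e.target)
    (u : EuclideanSpace ℝ (Fin (2 * n + 1))) :
    mfderiv (𝓡 (2 * n + 1)) (𝓡 (2 * n + 1)) e (e.symm y)
      (chartSymmDeriv e y u) = u :=
  congrArg (fun L => L u) ((e.mdifferentiable_of_mem_maximalAtlas he).comp_symm_deriv hy)

lemma chartSymmDeriv_mfderiv (he : e ∈ IsManifold.maximalAtlas (𝓡 (2 * n + 1)) ∞ M)
    {y : EuclideanSpace ℝ (Fin (2 * n + 1))} (hy : y ∈ e.target)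
    (x : TangentSpace (𝓡 (2 * n + 1)) (e.symm y)) :
    chartSymmDeriv e y
      (mfderiv (𝓡 (2 * n + 1)) (𝓡 (2 * n + 1)) e (e.symm y) x) = x := by
  have h := congrArg (fun L => L x)
    ((e.mdifferentiable_of_mem_maximalAtlas he).symm_comp_deriv (e.map_target hy))
  -- The base point `e (e.symm y)` occurs in a dependent type, hence the generalization to `q`.
  have hF : ∀ (q : EuclideanSpace ℝ (Fin (2 * n + 1))), q = y →
      ∀ t : EuclideanSpace ℝ (Fin (2 * n + 1)),
      (chartSymmDeriv e q t : EuclideanSpace ℝ (Fin (2 * n + 1)))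
        = chartSymmDeriv e y t := by
    rintro q rfl t
    rfl
  exact (hF _ (e.right_inv hy) _).symm.trans h

lemma chartSymmDeriv_eq_zero_iff (he : e ∈ IsManifold.maximalAtlas (𝓡 (2 * n + 1)) ∞ M)
    {y : EuclideanSpace ℝ (Fin (2 * n + 1))} (hy : y ∈ e.target)
    {u : EuclideanSpace ℝ (Fin (2 * n + 1))} : chartSymmDeriv e y u = 0 ↔ u = 0 := by
  refine ⟨fun h => ?_, fun h => by rw [h, map_zero]⟩
  rw [← mfderiv_chartSymmDeriv he hy u, h, map_zero]
  rfl

lemma chartSymmDeriv_injective (he : e ∈ IsManifold.maximalAtlas (𝓡 (2 * n + 1)) ∞ M)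
    {y : EuclideanSpace ℝ (Fin (2 * n + 1))} (hy : y ∈ e.target)
    {u v : EuclideanSpace ℝ (Fin (2 * n + 1))} (h : chartSymmDeriv e y u = chartSymmDeriv e y v) :
    u = v := by
  rw [← mfderiv_chartSymmDeriv he hy u, h, mfderiv_chartSymmDeriv he hy v]

lemma chartSymmDeriv_chartVector (w : ∀ p : M, TangentSpace (𝓡 (2 * n + 1)) p)
    (he : e ∈ IsManifold.maximalAtlas (𝓡 (2 * n + 1)) ∞ M)
    {y : EuclideanSpace ℝ (Fin (2 * n + 1))} (hy : y ∈ e.target) :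
    chartSymmDeriv e y (chartVector w e y) = w (e.symm y) :=
  chartSymmDeriv_mfderiv he hy _

/-- A statement about the points and tangent vectors over the domain of a chart may be checked in
coordinates. -/
lemma forall_tangent_of_chart (he : e ∈ IsManifold.maximalAtlas (𝓡 (2 * n + 1)) ∞ M)
    {P : ∀ p : M, TangentSpace (𝓡 (2 * n + 1)) p → TangentSpace (𝓡 (2 * n + 1)) p → Prop}
    (h : ∀ y ∈ e.target, ∀ u v : EuclideanSpace ℝ (Fin (2 * n + 1)),
      P (e.symm y) (chartSymmDeriv e y u)
        (chartSymmDeriv e y v)) :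
    ∀ p ∈ e.source, ∀ x z, P p x z := by
  intro p hp
  obtain ⟨y, hy, rfl⟩ : ∃ y ∈ e.target, e.symm y = p := ⟨e p, e.map_source hp, e.left_inv hp⟩
  intro x z
  rw [← chartSymmDeriv_mfderiv he hy x, ← chartSymmDeriv_mfderiv he hy z]
  exact h y hy _ _

variable [IsManifold (𝓡 (2 * n + 1)) ∞ M]

/-- The coordinate expression of the `1`-form `η` in the chart `e`. -/
def chartEta (S : AlmostContactBMetric n M)
    (e : OpenPartialHomeomorph M (EuclideanSpace ℝ (Fin (2 * n + 1))))
    (y : EuclideanSpace ℝ (Fin (2 * n + 1))) : EuclideanSpace ℝ (Fin (2 * n + 1)) →L[ℝ] ℝ :=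
  (S.η (e.symm y)).comp (chartSymmDeriv e y)

lemma contMDiffAt_chartSymmDeriv (he : e ∈ IsManifold.maximalAtlas (𝓡 (2 * n + 1)) ∞ M)
    {y : EuclideanSpace ℝ (Fin (2 * n + 1))} (hy : y ∈ e.target)
    (u : EuclideanSpace ℝ (Fin (2 * n + 1))) :
    ContMDiffAt (𝓡 (2 * n + 1)) (𝓡 (2 * n + 1)).tangent ∞
      (fun x => TotalSpace.mk' (EuclideanSpace ℝ (Fin (2 * n + 1)))
        (E := (TangentSpace (𝓡 (2 * n + 1)) : M → Type _)) (e.symm x)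
        (chartSymmDeriv e x u)) y := by
  have h1 := (contMDiffOn_symm_of_mem_maximalAtlas he).contMDiffOn_tangentMapWithin (m := ∞)
    (by simp) e.open_target.uniqueMDiffOn
  have h2 : ContMDiffAt (𝓡 (2 * n + 1)) (𝓡 (2 * n + 1)).tangent ∞
      (fun x => (⟨x, u⟩ : TangentBundle (𝓡 (2 * n + 1)) (EuclideanSpace ℝ (Fin (2 * n + 1))))) y :=
    contMDiffAt_vectorSpace_iff_contDiffAt.2 contDiffAt_const
  have h3 := (h1 ⟨y, u⟩ hy).contMDiffAt ((e.open_target.preimage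
    (FiberBundle.continuous_proj (EuclideanSpace ℝ (Fin (2 * n + 1)))
      (TangentSpace (𝓡 (2 * n + 1))))).mem_nhds hy)
  refine (ContMDiffAt.comp y h3 h2).congr_of_eventuallyEq ?_
  filter_upwards [e.open_target.mem_nhds hy] with x hx
  simp only [Function.comp_apply, tangentMapWithin, mfderivWithin_of_isOpen e.open_target hx]
  rfl

/-- If `w` is smooth as a vector field along `e.symm`, then its coordinate expression is smooth. -/
lemma contDiffAt_mfderiv_apply (he : e ∈ IsManifold.maximalAtlas (𝓡 (2 * n + 1)) ∞ M)
    {y : EuclideanSpace ℝ (Fin (2 * n + 1))} (hy : y ∈ e.target)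
    {w : ∀ x : EuclideanSpace ℝ (Fin (2 * n + 1)), TangentSpace (𝓡 (2 * n + 1)) (e.symm x)}
    (hw : ContMDiffAt (𝓡 (2 * n + 1)) (𝓡 (2 * n + 1)).tangent ∞
      (fun x => TotalSpace.mk' (EuclideanSpace ℝ (Fin (2 * n + 1)))
        (E := (TangentSpace (𝓡 (2 * n + 1)) : M → Type _)) (e.symm x) (w x)) y) :
    ContDiffAt ℝ ∞ (fun x => (mfderiv (𝓡 (2 * n + 1)) (𝓡 (2 * n + 1)) e (e.symm x) (w x) :
      EuclideanSpace ℝ (Fin (2 * n + 1)))) y := by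
  have h1 := (contMDiffOn_of_mem_maximalAtlas he).contMDiffOn_tangentMapWithin (m := ∞)
    (by simp) e.open_source.uniqueMDiffOn
  have h2 := (h1 ⟨e.symm y, w y⟩ (e.map_target hy)).contMDiffAt ((e.open_source.preimage
    (FiberBundle.continuous_proj (EuclideanSpace ℝ (Fin (2 * n + 1)))
      (TangentSpace (𝓡 (2 * n + 1))))).mem_nhds (e.map_target hy))
  have h3 := ContMDiffAt.comp y h2 hw
  refine contMDiffAt_vectorSpace_iff_contDiffAt.1 (h3.congr_of_eventuallyEq ?_)
  filter_upwards [e.open_target.mem_nhds hy] with x hx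
  simp [tangentMapWithin, mfderivWithin_of_isOpen e.open_source (e.map_target hx)]
  exact TotalSpace.ext (e.right_inv hx).symm HEq.rfl

lemma contDiffAt_chartMetric (S : AlmostContactBMetric n M)
    (he : e ∈ IsManifold.maximalAtlas (𝓡 (2 * n + 1)) ∞ M)
    {y : EuclideanSpace ℝ (Fin (2 * n + 1))} (hy : y ∈ e.target) :
    ContDiffAt ℝ ∞ (S.chartMetric e) y := by
  refine contDiffAt_of_forall_clm_apply e.open_target (fun y hy u => ?_) hy
  refine contDiffAt_of_forall_clm_apply e.open_target (fun y hy v => ?_) hy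
  have h := (S.contMDiff_g.contMDiffAt.comp y (contMDiffAt_symm_of_mem_maximalAtlas he hy))
  have h' := ContMDiffAt.clm_bundle_apply₂ (F₁ := EuclideanSpace ℝ (Fin (2 * n + 1)))
    (F₂ := EuclideanSpace ℝ (Fin (2 * n + 1))) (F₃ := ℝ) (E₃ := Bundle.Trivial M ℝ)
    (b := e.symm) (ψ := fun x => S.g (e.symm x)) h
    (contMDiffAt_chartSymmDeriv he hy u) (contMDiffAt_chartSymmDeriv he hy v)
  exact (contMDiffAt_totalSpace.1 h').2.contDiffAt

lemma contDiffAt_chartEta (S : AlmostContactBMetric n M)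
    (he : e ∈ IsManifold.maximalAtlas (𝓡 (2 * n + 1)) ∞ M)
    {y : EuclideanSpace ℝ (Fin (2 * n + 1))} (hy : y ∈ e.target) :
    ContDiffAt ℝ ∞ (S.chartEta e) y := by
  refine contDiffAt_of_forall_clm_apply e.open_target (fun y hy u => ?_) hy
  have h := (S.contMDiff_η.contMDiffAt.comp y (contMDiffAt_symm_of_mem_maximalAtlas he hy))
  have h' := ContMDiffAt.clm_bundle_apply (F₁ := EuclideanSpace ℝ (Fin (2 * n + 1)))
    (F₂ := ℝ) (E₂ := Bundle.Trivial M ℝ) (b := e.symm) (ϕ := fun x => S.η (e.symm x)) h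
    (contMDiffAt_chartSymmDeriv he hy u)
  exact (contMDiffAt_totalSpace.1 h').2.contDiffAt

lemma contDiffAt_chartPhi (S : AlmostContactBMetric n M)
    (he : e ∈ IsManifold.maximalAtlas (𝓡 (2 * n + 1)) ∞ M)
    {y : EuclideanSpace ℝ (Fin (2 * n + 1))} (hy : y ∈ e.target) :
    ContDiffAt ℝ ∞ (S.chartPhi e) y := by
  refine contDiffAt_of_forall_clm_apply e.open_target (fun y hy u => ?_) hy
  have h := (S.contMDiff_φ.contMDiffAt.comp y (contMDiffAt_symm_of_mem_maximalAtlas he hy))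
  exact contDiffAt_mfderiv_apply he hy
    (ContMDiffAt.clm_bundle_apply (F₁ := EuclideanSpace ℝ (Fin (2 * n + 1)))
      (F₂ := EuclideanSpace ℝ (Fin (2 * n + 1))) (b := e.symm) (ϕ := fun x => S.φ (e.symm x)) h
      (contMDiffAt_chartSymmDeriv he hy u))

lemma contDiffAt_chartVector_ξ (S : AlmostContactBMetric n M)
    (he : e ∈ IsManifold.maximalAtlas (𝓡 (2 * n + 1)) ∞ M)
    {y : EuclideanSpace ℝ (Fin (2 * n + 1))} (hy : y ∈ e.target) :
    ContDiffAt ℝ ∞ (chartVector S.ξ e) y :=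
  contDiffAt_mfderiv_apply he hy
    (S.contMDiff_ξ.contMDiffAt.comp y (contMDiffAt_symm_of_mem_maximalAtlas he hy))

lemma g_nondeg (S : AlmostContactBMetric n M) (p : M) (x : TangentSpace (𝓡 (2 * n + 1)) p)
    (h : ∀ z, S.g p x z = 0) : x = 0 := by
  obtain ⟨b, hb⟩ := S.g_signature p
  rw [← b.repr.map_eq_zero_iff]
  ext i
  have hi := h (b i)
  rw [← b.sum_repr x] at hi
  simp only [map_sum, map_smul, sum_apply, smul_apply, hb, smul_eq_mul, mul_ite, mul_zero,
    Finset.sum_ite_eq', Finset.mem_univ, if_true] at hi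
  rcases i with i | i <;> simpa using hi

/-- The tensor `∇φ` of the manifold at the point with coordinates `y`. -/
lemma nablaPhi_chartSymmDeriv (S : AlmostContactBMetric n M)
    (he : e ∈ IsManifold.maximalAtlas (𝓡 (2 * n + 1)) ∞ M)
    {y : EuclideanSpace ℝ (Fin (2 * n + 1))} (hy : y ∈ e.target)
    (u v : EuclideanSpace ℝ (Fin (2 * n + 1))) :
    S.nablaPhi e (e.symm y) (chartSymmDeriv e y u)
        (chartSymmDeriv e y v)
      = chartSymmDeriv e y
        (LocalGeometry.nablaEnd (S.chartMetric e) (S.chartPhi e) y u v) := by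
  -- The point `e (e.symm y)` is replaced by `y` inside a dependent type by generalizing it to `q`.
  have h : ∀ q s t : EuclideanSpace ℝ (Fin (2 * n + 1)), q = y → s = u → t = v →
      (chartSymmDeriv e q
        (LocalGeometry.nablaEnd (S.chartMetric e) (S.chartPhi e) q s t) :
          EuclideanSpace ℝ (Fin (2 * n + 1)))
        = chartSymmDeriv e y
          (LocalGeometry.nablaEnd (S.chartMetric e) (S.chartPhi e) y u v) := by
    rintro q s t rfl rfl rfl
    rfl
  exact h _ _ _ (e.right_inv hy) (mfderiv_chartSymmDeriv he hy u) (mfderiv_chartSymmDeriv he hy v)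

lemma ricci_chartSymmDeriv (S : AlmostContactBMetric n M)
    (he : e ∈ IsManifold.maximalAtlas (𝓡 (2 * n + 1)) ∞ M)
    {y : EuclideanSpace ℝ (Fin (2 * n + 1))} (hy : y ∈ e.target)
    (u v : EuclideanSpace ℝ (Fin (2 * n + 1))) :
    S.ricci e (e.symm y) (chartSymmDeriv e y u)
        (chartSymmDeriv e y v)
      = LocalGeometry.ricci (S.chartMetric e) y u v := by
  rw [ricci, mfderiv_chartSymmDeriv he hy, mfderiv_chartSymmDeriv he hy, e.right_inv hy]

lemma lieMetric_chartSymmDeriv (S : AlmostContactBMetric n M)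
    (w : ∀ p : M, TangentSpace (𝓡 (2 * n + 1)) p)
    (he : e ∈ IsManifold.maximalAtlas (𝓡 (2 * n + 1)) ∞ M)
    {y : EuclideanSpace ℝ (Fin (2 * n + 1))} (hy : y ∈ e.target)
    (u v : EuclideanSpace ℝ (Fin (2 * n + 1))) :
    S.lieMetric w e (e.symm y) (chartSymmDeriv e y u)
        (chartSymmDeriv e y v)
      = LocalGeometry.lieMetric (chartVector w e) (S.chartMetric e) y u v := by
  rw [lieMetric, mfderiv_chartSymmDeriv he hy, mfderiv_chartSymmDeriv he hy, e.right_inv hy]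

lemma chartSymmDeriv_chartPhi (S : AlmostContactBMetric n M)
    (he : e ∈ IsManifold.maximalAtlas (𝓡 (2 * n + 1)) ∞ M)
    {y : EuclideanSpace ℝ (Fin (2 * n + 1))} (hy : y ∈ e.target)
    (u : EuclideanSpace ℝ (Fin (2 * n + 1))) :
    chartSymmDeriv e y (S.chartPhi e y u)
      = S.φ (e.symm y) (chartSymmDeriv e y u) :=
  chartSymmDeriv_mfderiv he hy _

lemma chartMetric_apply (S : AlmostContactBMetric n M)
    (y u v : EuclideanSpace ℝ (Fin (2 * n + 1))) :
    S.chartMetric e y u v = S.g (e.symm y) (chartSymmDeriv e y u)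
      (chartSymmDeriv e y v) := rfl

lemma chartEta_apply (S : AlmostContactBMetric n M)
    (y u : EuclideanSpace ℝ (Fin (2 * n + 1))) :
    S.chartEta e y u = S.η (e.symm y) (chartSymmDeriv e y u) := rfl

/-! ### Einstein-like Sasaki-like manifolds and solitons with potential `ξ` -/

lemma IsSasakiLike.sasakiLikeOn {S : AlmostContactBMetric n M} (hS : S.IsSasakiLike)
    (he : e ∈ IsManifold.maximalAtlas (𝓡 (2 * n + 1)) ∞ M) :
    SasakiLikeOn e.target (S.chartMetric e) (LocalGeometry.christoffelCLM (S.chartMetric e))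
      (S.chartPhi e) (chartVector S.ξ e) (S.chartEta e) := by
  refine LocalGeometry.sasakiLikeOn e.open_target (fun y hy => S.contDiffAt_chartMetric he hy)
    (fun y hy => S.contDiffAt_chartPhi he hy) (fun y hy => S.contDiffAt_chartVector_ξ he hy)
    (fun y hy => S.contDiffAt_chartEta he hy) (fun y hy u v => S.g_symm _ _ _)
    (fun y hy u h => ?_) (fun y hy => ?_) (fun y hy u => ?_) (fun y hy u => ?_) (fun y hy => ?_)
    (fun y hy u v => ?_) (fun y hy u v => ?_)
  · refine (chartSymmDeriv_eq_zero_iff he hy).1 ?_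
    refine S.g_nondeg _ _ fun z => ?_
    rw [← chartSymmDeriv_mfderiv he hy z]
    exact h _
  · refine (chartSymmDeriv_eq_zero_iff he hy).1 ?_
    rw [S.chartSymmDeriv_chartPhi he hy, chartSymmDeriv_chartVector _ he hy, S.φ_ξ]
  · refine chartSymmDeriv_injective he hy ?_
    simp only [map_add, map_neg, map_smul]
    rw [S.chartSymmDeriv_chartPhi he hy, S.chartSymmDeriv_chartPhi he hy,
      chartSymmDeriv_chartVector _ he hy, S.φ_φ, chartEta_apply]
  · rw [chartEta_apply, S.chartSymmDeriv_chartPhi he hy, S.η_φ]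
  · rw [chartEta_apply, chartSymmDeriv_chartVector _ he hy, S.η_ξ]
  · rw [chartMetric_apply, S.chartSymmDeriv_chartPhi he hy, S.chartSymmDeriv_chartPhi he hy, S.g_φ_φ]
    rfl
  · refine chartSymmDeriv_injective he hy ?_
    simp only [map_add, map_sub, map_smul]
    rw [← S.nablaPhi_chartSymmDeriv he hy, hS e he _ (e.map_target hy),
      chartSymmDeriv_chartVector _ he hy]
    rfl

/-- `(𝓛_ξ g)(x, z) = -2 g(x, φ z)`. -/
lemma IsSasakiLike.lieMetric_ξ {S : AlmostContactBMetric n M} (hS : S.IsSasakiLike)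
    (he : e ∈ IsManifold.maximalAtlas (𝓡 (2 * n + 1)) ∞ M) :
    ∀ p ∈ e.source, ∀ x z : TangentSpace (𝓡 (2 * n + 1)) p,
      S.lieMetric S.ξ e p x z = -2 * S.g p x (S.φ p z) := by
  refine forall_tangent_of_chart he fun y hy u v => ?_
  rw [S.lieMetric_chartSymmDeriv _ he hy, (hS.sasakiLikeOn he).lieMetric_V hy, chartMetric_apply,
    S.chartSymmDeriv_chartPhi he hy]

lemma IsSasakiLike.isEtaEinsteinWith {S : AlmostContactBMetric n M} (hS : S.IsSasakiLike)
    (h : S.IsEinsteinLike) : S.IsEtaEinsteinWith 0 (2 * n) := by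
  obtain ⟨a, b, c, h⟩ := h
  intro e he
  refine forall_tangent_of_chart he fun y hy u v => ?_
  have hL := hS.sasakiLikeOn he
  have hR : ∀ y ∈ e.target, ∀ u v,
      connRicci (LocalGeometry.christoffelCLM (S.chartMetric e)) y u v
        = S.ricci e (e.symm y) (chartSymmDeriv e y u)
          (chartSymmDeriv e y v) := fun y hy u v => by
    rw [S.ricci_chartSymmDeriv he hy, LocalGeometry.ricci_eq_connRicci hL.contDiff_A hy]
  rw [← hR y hy, hL.connRicci_eq_of_einsteinLike (a := a) (b := b) (c := c)
    (fun y hy u v => ?_) hy, finrank_euclideanSpace_fin, chartEta_apply, chartEta_apply]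
  · push_cast
    ring
  · rw [hR y hy, h e he _ (e.map_target hy), assocMetric, chartMetric_apply, chartMetric_apply,
      S.chartSymmDeriv_chartPhi he hy]
    rfl

lemma IsSasakiLike.isEtaEinsteinWith_iff {S : AlmostContactBMetric n M} (hS : S.IsSasakiLike) :
    S.IsEtaEinsteinWith 0 (2 * n) ↔ S.IsRicciLikeSoliton S.ξ 0 1 (-2 * n - 1) := by
  refine ⟨fun h => ⟨S.contMDiff_ξ, fun e he p hp x z => ?_⟩, fun h e he p hp x z => ?_⟩
  · rw [hS.lieMetric_ξ he p hp, h e he p hp, assocMetric]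
    ring
  · have := h.2 e he p hp x z
    rw [hS.lieMetric_ξ he p hp, assocMetric] at this
    linear_combination this

end AlmostContactBMetric
end

theorem corollary3p4 (n : ℕ) {M : Type*} [TopologicalSpace M]
    [ChartedSpace (EuclideanSpace ℝ (Fin (2 * n + 1))) M]
    [IsManifold (𝓡 (2 * n + 1)) ∞ M]
    (S : AlmostContactBMetric n M) (hS : S.IsSasakiLike) :
    (S.IsEinsteinLike →
      S.IsEtaEinsteinWith 0 (2 * n) ∧ S.IsRicciLikeSoliton S.ξ 0 1 (-2 * n - 1)) ∧
    (S.IsEtaEinsteinWith 0 (2 * n) ↔ S.IsRicciLikeSoliton S.ξ 0 1 (-2 * n - 1)) :=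
  ⟨fun h => ⟨hS.isEtaEinsteinWith h, hS.isEtaEinsteinWith_iff.1 (hS.isEtaEinsteinWith h)⟩,
    hS.isEtaEinsteinWith_iff⟩
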